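/- **Setting.** Let $\mathcal G=(\{1,\dots,n\},\mathcal E)$ be a connected undirected graph, $n,p\ge 1$. For $\mathbf x\in\mathbb R^{n\times p}$ with rows $\mathbf x_{(i)}\in\mathbb R^p$ use the Frobenius norm, and put $\bar{\mathbf x}=\frac1n\mathbf 1\mathbf 1^T\mathbf x$. Let $W=[w_{ij}]\in\mathbb R^{n\times n}$ be symmetric with $w_{ij}=0$ if $i\ne j$ and $(i,j)\notin\mathcal E$ and $w_{ij}>0$ otherwise, $\mathrm{null}(I-W)=\mathrm{span}\{\mathbf 1\}$, and $I\succeq W\succ -I$; $\lambda_n(W)$ denotes its smallest eigenvalue, and $\|\mathbf x\|_{I-W}^2=\langle \mathbf x,(I-W)\mathbf x\rangle$. For each $i$ let $f_i:\mathbb R^p\to\mathbb R$ be differentiable with $L_{f_i}$-Lipschitz gradient ($L_{f_i}>0$), and $r_i:\mathbb R^p\to\mathbb R\cup\{+\infty\}$, such that $f_i+r_i$ is proper, lower semicontinuous and coercive. Assume that for each $i$ the gradient $\nabla f_i$ is bounded on $\mathbb R^p$ and that the subgradients $\xi_i\in\partial r_i(u)$, $u\in\mathbb R^p$, are bounded by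 a constant ($\partial$ is the limiting subdifferential). Let $L_f=\max_i L_{f_i}$, $r(\mathbf x)=\sum_i r_i(\mathbf x_{(i)})$, $s(\mathbf x)=\sum_i\big(f_i(\mathbf x_{(i)})+r_i(\mathbf x_{(i)})\big)$, let $\nabla\mathbf f(\mathbf x)\in\mathbb R^{n\times p}$ have rows $\nabla f_i(\mathbf x_{(i)})^T$, and $$\hat{\mathcal L}_{\alpha}(\mathbf x)=\sum_{i=1}^n f_i(\mathbf x_{(i)})+\frac1{2\alpha}\|\mathbf x\|_{I-W}^2+r(\mathbf x).$$ The composite consensus problem is to minimize $s(\mathbf x)$ subject to $\mathbf x_{(i)}=\mathbf x_{(j)}$ for all $(i,j)\in\mathcal E$; a feasible $\mathbf x$ is called stationary for it if $\mathbf 1^T(\nabla\mathbf f(\mathbf x)+\xi)=0$ for some $\xi\in\partial r(\mathbf x)$. Let $0<\epsilon\le1$ and $\alpha_k=\frac{1}{L_f(k+1)^{\epsilon}}$, let $\mathbf x^0$ be arbitrary, and let $\{\mathbf x^k\}$ be any sequence generated by Prox-DGD, i.e. for $k=0,1,\dots$ $$\mathbf x^{k+1}\in\operatorname*{argmin}_{\mathbf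 u}\Big\{\alpha_k r(\mathbf u)+\tfrac12\big\|\mathbf u-\big(W\mathbf x^k-\alpha_k\nabla\mathbf f(\mathbf x^k)\big)\big\|^2\Big\}.$$ Let $\xi^{k+1}$ be defined by $\mathbf x^{k+1}+\alpha_k\xi^{k+1}=W\mathbf x^k-\alpha_k\nabla\mathbf f(\mathbf x^k)$. **Theorem 4.** The following hold. (a) If all $r_i$ are convex, or if $\lambda_n(W)>0$, then $\{\hat{\mathcal L}_{\alpha_k}(\mathbf x^k)\}$ and $\{s(\mathbf x^k)\}$ converge to the same (finite) limit. (b) If all $r_i$ are convex, then $\sum_{k=0}^\infty\big(\alpha_k^{-1}(1+\lambda_n(W))-L_f\big)\|\mathbf x^{k+1}-\mathbf x^k\|^2<\infty$. If $\lambda_n(W)>0$ (and the $r_i$ are not necessarily convex), then $\sum_{k=0}^\infty\big(\alpha_k^{-1}\lambda_n(W)-L_f\big)\|\mathbf x^{k+1}-\mathbf x^k\|^2<\infty$. (c) One has $\xi^{k+1}\in\partial r(\mathbf x^{k+1})$ for all $k\ge0$. If there are a constant $L_r>0$ and an integer $k_0>0$ with $\|\xi^{k+1}-\xi^k\|\le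 L_r\|\mathbf x^{k+1}-\mathbf x^k\|$ for all $k>k_0$, then $\lim_{k\to\infty}\mathbf 1^T(\nabla\mathbf f(\mathbf x^k)+\xi^{k+1})=0$, and any limit point of $\{\mathbf x^k\}$ is a stationary point of the composite consensus problem. (d) If $\{\mathbf x^k\}$ has an isolated accumulation point, then $\{\mathbf x^k\}$ converges to that point. (e) If all $f_i$ and $r_i$ are convex and $\lambda_n(W)>0$, then the composite consensus problem has a finite attained optimal value $s_{\mathrm{opt}}$, and $$\bar s^K=\frac{\sum_{k=0}^K\alpha_k\, s(\bar{\mathbf x}^{k+1})}{\sum_{k=0}^K\alpha_k}$$ is finite for every $K$ and converges to $s_{\mathrm{opt}}$ as $K\to\infty$, with $|\bar s^K-s_{\mathrm{opt}}|$ of the order $\mathcal O(K^{-\epsilon})$ if $0<\epsilon<\frac12$; $\mathcal O(\ln K/\sqrt K)$ if $\epsilon=\frac12$; $\mathcal O(K^{-(1-\epsilon)})$ if $\frac12<\epsilon<1$; $\mathcal O(1/\ln K)$ if $\epsilon=1$. -/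

import Mathlib

open Filter Topology Asymptotics
open scoped BigOperators

noncomputable section

namespace ProxDGD

/-- The space `ℝᵖ` with its Euclidean norm. -/
abbrev Vec (p : ℕ) : Type := EuclideanSpace ℝ (Fin p)

/-- The space `ℝⁿˣᵖ` of stacked local copies (the rows are `x i`), with the Frobenius norm. -/
abbrev Stack (n p : ℕ) : Type := PiLp 2 (fun _ : Fin n => Vec p)

/-! ### Extended-real-valued functions and subdifferentials -/

section Functions

variable {E : Type*} [NormedAddCommGroup E] [InnerProductSpace ℝ E]

/-- `h` takes values in `ℝ ∪ {+∞}` and is not identically `+∞`. -/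
def IsProper (h : E → EReal) : Prop :=
  (∀ x, h x ≠ ⊥) ∧ ∃ x, h x ≠ ⊤

/-- `h u → +∞` as `‖u‖ → +∞`. -/
def IsCoercive (h : E → EReal) : Prop :=
  Tendsto h (comap (fun u : E => ‖u‖) atTop) (𝓝 ⊤)

/-- Convexity of an extended-real-valued function: its epigraph is convex. -/
def IsConvexFun (h : E → EReal) : Prop :=
  Convex ℝ {q : E × ℝ | h q.1 ≤ (q.2 : EReal)}

/-- The Fréchet (regular) subdifferential of `h` at `x`:
`h y ≥ h x + ⟪v, y - x⟫ + o(‖y - x‖)`; it is empty where `h` is not finite. -/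
def frechetSubdiff (h : E → EReal) (x : E) : Set E :=
  {v | h x ≠ ⊤ ∧ h x ≠ ⊥ ∧ ∀ δ : ℝ, 0 < δ → ∀ᶠ y in 𝓝 x,
    h x + ((inner ℝ v (y - x) - δ * ‖y - x‖ : ℝ) : EReal) ≤ h y}

/-- The limiting (Mordukhovich) subdifferential of `h` at `x`; it is empty where `h` is not
finite. For a proper lower semicontinuous convex function it is the usual convex
subdifferential. -/
def subdiff (h : E → EReal) (x : E) : Set E :=
  {v | h x ≠ ⊤ ∧ h x ≠ ⊥ ∧ ∃ (y : ℕ → E) (w : ℕ → E),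
    Tendsto y atTop (𝓝 x) ∧ Tendsto (fun m => h (y m)) atTop (𝓝 (h x)) ∧
    (∀ m, w m ∈ frechetSubdiff h (y m)) ∧ Tendsto w atTop (𝓝 v)}

/-- The (set-valued) proximal operator
`prox_{a h}(y) = argmin_u { a h(u) + ‖u - y‖² / 2 }`. -/
def prox (a : ℝ) (h : E → EReal) (y : E) : Set E :=
  {z | ∀ u, (a : EReal) * h z + ((‖z - y‖ ^ 2 / 2 : ℝ) : EReal) ≤
    (a : EReal) * h u + ((‖u - y‖ ^ 2 / 2 : ℝ) : EReal)}

/-- `h` is differentiable and its gradient is Lipschitz with constant `L > 0`. -/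
def IsLipschitzDifferentiable [CompleteSpace E] (h : E → ℝ) (L : ℝ) : Prop :=
  0 < L ∧ Differentiable ℝ h ∧ ∀ u v, ‖gradient h u - gradient h v‖ ≤ L * ‖u - v‖

end Functions

/-! ### The network -/

/-- The assumptions on the mixing matrix `W` of the network `G`. -/
structure IsMixingMatrix {n : ℕ} (G : SimpleGraph (Fin n)) (W : Matrix (Fin n) (Fin n) ℝ) :
    Prop where
  /-- nonadjacent distinct nodes have weight zero -/
  graph_zero : ∀ i j, i ≠ j → ¬ G.Adj i j → W i j = 0
  /-- all the other weights (the diagonal ones included) are positive -/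
  graph_pos : ∀ i j, i = j ∨ G.Adj i j → 0 < W i j
  symm : W.IsSymm
  null_space : LinearMap.ker (Matrix.toLin' (1 - W)) = Submodule.span ℝ {fun _ => (1 : ℝ)}
  /-- `I ⪰ W` -/
  le_one : (1 - W).PosSemidef
  /-- `W ≻ -I` -/
  neg_one_lt : (W + 1).PosDef

variable {n p : ℕ}

/-- The smallest eigenvalue `λ_n(W)` of a symmetric matrix. -/
def lamMin (W : Matrix (Fin n) (Fin n) ℝ) : ℝ := sInf (spectrum ℝ W)

/-- The matrix product `W x`. -/
def mix (W : Matrix (Fin n) (Fin n) ℝ) (x : Stack n p) : Stack n p :=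
  WithLp.toLp 2 fun i => ∑ j, W i j • x j

/-- `‖x‖²_{I - W} = ⟨x, (I - W) x⟩`. -/
def seminormSq (W : Matrix (Fin n) (Fin n) ℝ) (x : Stack n p) : ℝ :=
  inner ℝ x (x - mix W x)

/-- The stacked average: each row of it is the mean of the rows of `x`. -/
def avg (x : Stack n p) : Stack n p :=
  WithLp.toLp 2 fun _ => (n : ℝ)⁻¹ • ∑ j, x j

/-- The feasible set of the consensus problem: `x_(i) = x_(j)` for each edge `(i, j)`. -/
def consensusSet (G : SimpleGraph (Fin n)) : Set (Stack n p) :=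
  {x | ∀ i j, G.Adj i j → x i = x j}

/-! ### The objective -/

/-- `∑ i, f_i (x_(i))`. -/
def smoothSum (f : Fin n → Vec p → ℝ) (x : Stack n p) : ℝ := ∑ i, f i (x i)

/-- `r(x) = ∑ i, r_i (x_(i))`. -/
def rSum (r : Fin n → Vec p → EReal) (x : Stack n p) : EReal := ∑ i, r i (x i)

/-- The stacked gradient `∇f(x)`, with rows `∇f_i (x_(i))`. -/
def gradStack (f : Fin n → Vec p → ℝ) (x : Stack n p) : Stack n p :=
  WithLp.toLp 2 fun i => gradient (f i) (x i)

/-- The composite objective `s(x) = ∑ i, (f_i (x_(i)) + r_i (x_(i)))`. -/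
def objective (f : Fin n → Vec p → ℝ) (r : Fin n → Vec p → EReal) (x : Stack n p) : EReal :=
  ∑ i, ((f i (x i) : EReal) + r i (x i))

/-- The Lyapunov function `∑ i, f_i (x_(i)) + ‖x‖²_{I - W} / (2 a) + r(x)`. -/
def lyapunov (W : Matrix (Fin n) (Fin n) ℝ) (f : Fin n → Vec p → ℝ) (r : Fin n → Vec p → EReal)
    (a : ℝ) (x : Stack n p) : EReal :=
  ((smoothSum f x + 1 / (2 * a) * seminormSq W x : ℝ) : EReal) + rSum r x

/-- First-order stationary points of `min s(x)` subject to consensus over the edges of `G`: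
`x` is feasible and `1ᵀ(∇f(x) + ξ) = 0` for some `ξ ∈ ∂r(x)`. Over a connected graph this is
`0 ∈ ∇f(x) + ∂r(x) + N(x)`, with `N(x)` the normal cone of the feasible subspace. -/
def IsStationary (G : SimpleGraph (Fin n)) (f : Fin n → Vec p → ℝ) (r : Fin n → Vec p → EReal)
    (x : Stack n p) : Prop :=
  x ∈ consensusSet G ∧ ∃ ξ ∈ subdiff (rSum r) x, ∑ i, (gradStack f x i + ξ i) = 0

/-! ### The algorithm -/

/-- The constant `L_f = max_i L_{f_i}`. -/
def maxConst (L : Fin n → ℝ) : ℝ := ⨆ i, L i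

/-- The step sizes `α_k = 1 / (L_f (k + 1)^ε)`. -/
def stepSize (Lf ε : ℝ) (k : ℕ) : ℝ := 1 / (Lf * ((k : ℝ) + 1) ^ ε)

/-- `x` is a sequence generated by Prox-DGD with step sizes `α` (from an arbitrary `x 0`). -/
def IsProxDGD (W : Matrix (Fin n) (Fin n) ℝ) (f : Fin n → Vec p → ℝ)
    (r : Fin n → Vec p → EReal) (α : ℕ → ℝ) (x : ℕ → Stack n p) : Prop :=
  ∀ k, x (k + 1) ∈ prox (α k) (rSum r) (mix W (x k) - α k • gradStack f (x k))

/-- `ξ (k + 1)` is the prox-subgradient of the `k`-th step of Prox-DGD: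
`x (k + 1) + α_k ξ (k + 1) = W x (k) - α_k ∇f(x (k))`. (The entry `ξ 0` plays no role.) -/
def IsProxSubgradSeq (W : Matrix (Fin n) (Fin n) ℝ) (f : Fin n → Vec p → ℝ)
    (α : ℕ → ℝ) (x ξ : ℕ → Stack n p) : Prop :=
  ∀ k, x (k + 1) + α k • ξ (k + 1) = mix W (x k) - α k • gradStack f (x k)

/-- The ergodic objective `(∑_{k ≤ K} α_k s(x̄^{k+1})) / ∑_{k ≤ K} α_k`. -/
def ergodicObjective (f : Fin n → Vec p → ℝ) (r : Fin n → Vec p → EReal) (α : ℕ → ℝ)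
    (x : ℕ → Stack n p) (K : ℕ) : EReal :=
  (∑ k ∈ Finset.range (K + 1), (α k : EReal) * objective f r (avg (x (k + 1)))) /
    ((∑ k ∈ Finset.range (K + 1), α k : ℝ) : EReal)

end ProxDGD

end

/-!
Where an `r i` jumps to `⊤` or grows steeply it has large regular subgradients, so bounded
subgradients force each `r i` to be finite and Lipschitz. The prox subgradients are therefore
bounded, and Prox-DGD reads `x (k + 1) = W (x k) + O(α k)`. Since `W` fixes the consensus subspace
and contracts its orthogonal complement, the disagreement of the iterates and their increments are
`O(α k)`.

The penalized objective is bounded below and decreases along the iteration up to a drift of order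
`(1 / α (k + 1) - 1 / α k) * α k ^ 2`, which is summable; hence the values converge, and the squared
increments are summable against `1 / α k`. The squared norm of the consensus part of
`∇f (x k) + ξ (k + 1)` is summable against `α k`, so when this direction varies no faster than the
iterates and `∑ α k` diverges, its consensus part tends to zero. In the convex case, the subgradient
inequalities along the averaged iterates telescope to an `O((1 + ∑ α k ^ 2) / ∑ α k)` bound on the
ergodic objective gap.
-/

noncomputable section

namespace ProxDGD

section Sequences

theorem tendsto_and_summable_of_le_sub {V u : ℕ → ℝ} {b : ℝ} (hb : ∀ k, b ≤ V k)
    (hV : ∀ k, V (k + 1) ≤ V k - u k) (hu : ∀ k, 0 ≤ u k) :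
    (∃ l, Tendsto V atTop (𝓝 l)) ∧ Summable u := by
  have hanti : Antitone V := antitone_nat_of_succ_le fun k => by linarith [hV k, hu k]
  have htelescope : ∀ m, ∑ k ∈ Finset.range m, u k ≤ V 0 - V m := fun m => by
    rw [← Finset.sum_range_sub']
    exact Finset.sum_le_sum fun k _ => by linarith [hV k]
  refine ⟨⟨_, tendsto_atTop_ciInf hanti ⟨b, by rintro _ ⟨k, rfl⟩; exact hb k⟩⟩, ?_⟩
  exact summable_of_sum_range_le hu fun m => (htelescope m).trans (sub_le_sub_left (hb m) _)

theorem tendsto_and_summable_of_eventually_le_sub_add {V u e : ℕ → ℝ} {b : ℝ}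
    (hb : ∀ k, b ≤ V k) (hV : ∀ᶠ k in atTop, V (k + 1) ≤ V k - u k + e k)
    (hu : ∀ᶠ k in atTop, 0 ≤ u k) (he : Summable e) :
    (∃ l, Tendsto V atTop (𝓝 l)) ∧ Summable u := by
  obtain ⟨N, hN⟩ := eventually_atTop.1 (hV.and hu)
  have hE := he.hasSum.tendsto_sum_nat
  obtain ⟨B, hB⟩ := hE.bddAbove_range
  set A : ℕ → ℝ := fun k => V k - ∑ j ∈ Finset.range k, e j with hA
  have hbelow : ∀ k, b - B ≤ A k := fun k => sub_le_sub (hb k) (hB ⟨k, rfl⟩)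
  have hdescent : ∀ m, A (m + 1 + N) ≤ A (m + N) - u (m + N) := fun m => by
    have := (hN (m + N) le_add_self).1
    rw [add_right_comm]
    simp only [hA, Finset.sum_range_succ]
    linarith
  obtain ⟨⟨l, hl⟩, hsum⟩ := tendsto_and_summable_of_le_sub (V := fun m => A (m + N))
    (u := fun m => u (m + N)) (fun m => hbelow _) hdescent fun m => (hN _ le_add_self).2
  refine ⟨⟨_, (((tendsto_add_atTop_iff_nat N).1 hl).add hE).congr fun k => ?_⟩,
    (summable_nat_add_iff N).1 hsum⟩
  exact sub_add_cancel _ _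

theorem summable_of_coupled_descent {V a β e e' η : ℕ → ℝ} {b c q : ℝ} (hb : ∀ k, b ≤ V k)
    (ha : ∀ k, 0 ≤ a k) (hβ : ∀ k, 0 ≤ β k) (hc : 0 < c) (hq : q < 1)
    (hV : ∀ᶠ k in atTop, V (k + 1) ≤ V k - c * β k + a k + e k)
    (haβ : ∀ᶠ k in atTop, a (k + 1) ≤ q * a k + η k * β k + e' k)
    (hη : Tendsto η atTop (𝓝 0)) (he : Summable e) (he' : Summable e') : Summable β := by
  -- The weight `M` absorbs `a k` into the decrease of `M * a k`.
  set M := (1 - q)⁻¹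
  have hM : 0 < M := inv_pos.2 (sub_pos.2 hq)
  have hMq : M * q = M - 1 := by
    linarith [inv_mul_cancel₀ (sub_pos.2 hq).ne']
  have hMη : ∀ᶠ k in atTop, M * η k < c / 2 := by
    have hlim : Tendsto (fun k => M * η k) atTop (𝓝 0) := by simpa using hη.const_mul M
    exact hlim.eventually (eventually_lt_nhds (half_pos hc))
  have hdescent : ∀ᶠ k in atTop,
      V (k + 1) + M * a (k + 1) ≤ V k + M * a k - c / 2 * β k + (e k + M * e' k) := by
    filter_upwards [hV, haβ, hMη] with k hVk hak hηk
    have hweighted := mul_le_mul_of_nonneg_left hak hM.le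
    have hsmall := mul_le_mul_of_nonneg_right hηk.le (hβ k)
    linear_combination hVk + hweighted + hsmall + a k * hMq
  have hsum := (tendsto_and_summable_of_eventually_le_sub_add (V := fun k => V k + M * a k)
    (fun k => (hb k).trans (le_add_of_nonneg_right (mul_nonneg hM.le (ha k)))) hdescent
    (Eventually.of_forall fun k => mul_nonneg (half_pos hc).le (hβ k))
    (he.add (he'.mul_left M))).2
  exact (summable_mul_left_iff (half_pos hc).ne').1 hsum

theorem eventually_le_of_affine_contraction {q : ℕ → ℝ} {ρ D : ℝ} (hρ : 0 ≤ ρ) (hρ1 : ρ < 1)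
    (h : ∀ᶠ k in atTop, q (k + 1) ≤ ρ * q k + D) : ∃ C, ∀ᶠ k in atTop, q k ≤ C := by
  obtain ⟨N, hN⟩ := eventually_atTop.1 h
  set C := max (q N) (D / (1 - ρ))
  have hD : D ≤ (1 - ρ) * C := by
    rw [mul_comm, ← div_le_iff₀ (sub_pos.2 hρ1)]
    exact le_max_right _ _
  refine ⟨C, eventually_atTop.2 ⟨N, fun k hk => ?_⟩⟩
  induction k, hk using Nat.le_induction with
  | base => exact le_max_left _ _
  | succ k hk ih =>
    calc q (k + 1) ≤ ρ * q k + D := hN k hk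
      _ ≤ ρ * C + (1 - ρ) * C := by gcongr
      _ = C := by ring

theorem eq_zero_of_tendsto_of_summable_mul {a u : ℕ → ℝ} {l : ℝ} (ha : ¬ Summable a)
    (hau : Summable fun k => a k * u k) (hu : Tendsto u atTop (𝓝 l)) : l = 0 := by
  by_contra hl
  refine ha (summable_of_isBigO_nat hau ?_)
  have hinv : (fun k => (u k)⁻¹) =O[atTop] fun _ => (1 : ℝ) := (hu.inv₀ hl).isBigO_one ℝ
  refine ((isBigO_refl (fun k => a k * u k) atTop).mul hinv).congr' ?_ (by simp)
  filter_upwards [hu.eventually_ne hl] with k hk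
  exact mul_inv_cancel_right₀ hk _

/-- The properties of the step sizes `1 / (L_f (k + 1) ^ ε)` on which the asymptotic analysis
relies. -/
structure IsVanishingStep (α : ℕ → ℝ) : Prop where
  pos : ∀ k, 0 < α k
  antitone : Antitone α
  tendsto_zero : Tendsto α atTop (𝓝 0)
  tendsto_ratio : Tendsto (fun k => α k / α (k + 1)) atTop (𝓝 1)

namespace IsVanishingStep

variable {α : ℕ → ℝ}

theorem succ_le (hα : IsVanishingStep α) (k : ℕ) : α (k + 1) ≤ α k :=
  hα.antitone k.le_succ

theorem summable_sub (hα : IsVanishingStep α) : Summable fun k => α k - α (k + 1) :=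
  (tendsto_and_summable_of_le_sub (fun k => (hα.pos k).le) (fun k => by simp)
    fun k => sub_nonneg.2 (hα.succ_le k)).2

theorem eventually_ratio_mul_lt (hα : IsVanishingStep α) {c d : ℝ} (h : c < d) :
    ∀ᶠ k in atTop, α k / α (k + 1) * c < d := by
  have hlim : Tendsto (fun k => α k / α (k + 1) * c) atTop (𝓝 c) := by
    simpa using hα.tendsto_ratio.mul_const c
  exact hlim.eventually (eventually_lt_nhds h)

theorem eventually_mul_lt (hα : IsVanishingStep α) (c : ℝ) {d : ℝ} (h : 0 < d) :
    ∀ᶠ k in atTop, c * α k < d := by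
  have hlim : Tendsto (fun k => c * α k) atTop (𝓝 0) := by
    simpa using hα.tendsto_zero.const_mul c
  exact hlim.eventually (eventually_lt_nhds h)

theorem isBigO_succ (hα : IsVanishingStep α) : (fun k => α (k + 1)) =O[atTop] α :=
  IsBigO.of_norm_le fun k => by
    rw [Real.norm_of_nonneg (hα.pos _).le]
    exact hα.succ_le k

theorem tendsto_inv (hα : IsVanishingStep α) : Tendsto (fun k => (α k)⁻¹) atTop atTop :=
  (tendsto_nhdsWithin_iff.2 ⟨hα.tendsto_zero, Eventually.of_forall hα.pos⟩).inv_tendsto_nhdsGT_zero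

theorem exists_forall_norm_le_mul {F : Type*} [NormedAddCommGroup F] (hα : IsVanishingStep α)
    {t : ℕ → F} (ht : t =O[atTop] α) : ∃ C, 0 < C ∧ ∀ k, ‖t k‖ ≤ C * α k := by
  obtain ⟨C, hC, h⟩ := bound_of_isBigO_nat_atTop ht
  refine ⟨C, hC, fun k => (h (hα.pos k).ne').trans_eq ?_⟩
  rw [Real.norm_of_nonneg (hα.pos k).le]

theorem isBigO_of_le_contraction {F : Type*} [NormedAddCommGroup F] (hα : IsVanishingStep α)
    {t : ℕ → F} {ρ D : ℝ} (hρ : 0 ≤ ρ) (hρ1 : ρ < 1) (hD : 0 ≤ D)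
    (h : ∀ k, ‖t (k + 1)‖ ≤ ρ * ‖t k‖ + D * α k) : t =O[atTop] α := by
  obtain ⟨ρ', hρρ', hρ'1⟩ := exists_between hρ1
  have hratio : ∀ᶠ k in atTop,
      ‖t (k + 1)‖ / α (k + 1) ≤ ρ' * (‖t k‖ / α k) + 2 * D := by
    filter_upwards [hα.eventually_ratio_mul_lt hρρ', hα.eventually_ratio_mul_lt one_lt_two]
      with k hcontract htwo
    have := hα.pos k
    have := hα.pos (k + 1)
    rw [mul_one] at htwo
    calc ‖t (k + 1)‖ / α (k + 1) ≤ (ρ * ‖t k‖ + D * α k) / α (k + 1) := by gcongr; exact h k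
      _ = α k / α (k + 1) * ρ * (‖t k‖ / α k) + α k / α (k + 1) * D := by field_simp
      _ ≤ ρ' * (‖t k‖ / α k) + 2 * D := by gcongr
  obtain ⟨C, hC⟩ := eventually_le_of_affine_contraction (q := fun k => ‖t k‖ / α k)
    (hρ.trans hρρ'.le) hρ'1 hratio
  refine IsBigO.of_bound C (hC.mono fun k hk => ?_)
  rw [Real.norm_of_nonneg (hα.pos k).le]
  exact (div_le_iff₀ (hα.pos k)).1 hk

theorem summable_dist_norm_pow_three {F : Type*} [NormedAddCommGroup F]
    (hα : IsVanishingStep α) {v : ℕ → F} (hs : Summable fun k => α k * ‖v k‖ ^ 2)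
    (hv : (fun k => v (k + 1) - v k) =O[atTop] α) :
    Summable fun k => dist (‖v k‖ ^ 3) (‖v (k + 1)‖ ^ 3) := by
  obtain ⟨C, hC, hvC⟩ := hα.exists_forall_norm_le_mul hv
  have hs' : Summable fun k => α (k + 1) * ‖v (k + 1)‖ ^ 2 := (summable_nat_add_iff 1).2 hs
  refine Summable.of_norm_bounded_eventually_nat ((hs.add (hs'.mul_left 2)).mul_left (2 * C)) ?_
  filter_upwards [hα.eventually_ratio_mul_lt one_lt_two] with k hk
  have htwo : α k ≤ 2 * α (k + 1) := ((div_lt_iff₀ (hα.pos _)).1 (by simpa using hk)).le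
  have hdist : |‖v k‖ - ‖v (k + 1)‖| ≤ C * α k :=
    (abs_norm_sub_norm_le _ _).trans (by rw [norm_sub_rev]; exact hvC k)
  have := hα.pos k
  set a := ‖v k‖
  set b := ‖v (k + 1)‖
  have : 0 ≤ a := norm_nonneg _
  have : 0 ≤ b := norm_nonneg _
  rw [Real.norm_of_nonneg dist_nonneg, Real.dist_eq]
  calc |a ^ 3 - b ^ 3| = |a - b| * (a ^ 2 + a * b + b ^ 2) := by
        rw [show a ^ 3 - b ^ 3 = (a - b) * (a ^ 2 + a * b + b ^ 2) by ring, abs_mul,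
          abs_of_nonneg (show 0 ≤ a ^ 2 + a * b + b ^ 2 by positivity)]
    _ ≤ C * α k * (2 * (a ^ 2 + b ^ 2)) := by
        gcongr
        nlinarith [sq_nonneg (a - b), sq_nonneg a, sq_nonneg b]
    _ = 2 * C * (α k * a ^ 2 + α k * b ^ 2) := by ring
    _ ≤ 2 * C * (α k * a ^ 2 + 2 * α (k + 1) * b ^ 2) := by gcongr
    _ = 2 * C * (α k * a ^ 2 + 2 * (α (k + 1) * b ^ 2)) := by ring

/- Cubing turns the two hypotheses into a single summable one:
`|‖v (k + 1)‖ ^ 3 - ‖v k‖ ^ 3|` is of the order of `α k * ‖v k‖ ^ 2`. -/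
theorem tendsto_zero_of_summable_mul_sq {F : Type*} [NormedAddCommGroup F]
    (hα : IsVanishingStep α) (hdiv : ¬ Summable α) {v : ℕ → F}
    (hs : Summable fun k => α k * ‖v k‖ ^ 2)
    (hv : (fun k => v (k + 1) - v k) =O[atTop] α) : Tendsto v atTop (𝓝 0) := by
  obtain ⟨l, hl⟩ := cauchySeq_tendsto_of_complete
    (cauchySeq_of_summable_dist (hα.summable_dist_norm_pow_three hs hv))
  have hroot : Tendsto (fun k => ‖v k‖) atTop (𝓝 (l ^ (3⁻¹ : ℝ))) :=
    (hl.rpow_const (Or.inr (by norm_num))).congr fun k =>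
      Real.pow_rpow_inv_natCast (norm_nonneg _) three_ne_zero
  have hzero := eq_zero_of_tendsto_of_summable_mul hdiv hs (hroot.pow 2)
  rw [pow_eq_zero_iff two_ne_zero] at hzero
  exact tendsto_zero_iff_norm_tendsto_zero.2 (hzero ▸ hroot)

end IsVanishingStep

variable {E : Type*} [PseudoMetricSpace E] {x : ℕ → E} {y : E}

theorem eventually_mem_ball_of_frequently_of_notMem_annulus {r : ℝ}
    (hstep : ∀ᶠ k in atTop, dist (x (k + 1)) (x k) < r)
    (hannulus : ∀ᶠ k in atTop, x k ∉ Metric.closedBall y (2 * r) \ Metric.ball y r)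
    (hfreq : ∃ᶠ k in atTop, x k ∈ Metric.ball y r) : ∀ᶠ k in atTop, x k ∈ Metric.ball y r := by
  obtain ⟨N, hN⟩ := eventually_atTop.1 (hstep.and hannulus)
  obtain ⟨m, hm, hxm⟩ := frequently_atTop.1 hfreq N
  refine eventually_atTop.2 ⟨m, fun k hk => ?_⟩
  induction k, hk using Nat.le_induction with
  | base => exact hxm
  | succ k hk ih =>
    by_contra hout
    refine (hN (k + 1) (by omega)).2 ⟨?_, hout⟩
    have hclose := (hN k (by omega)).1
    rw [Metric.mem_ball] at ih
    rw [Metric.mem_closedBall]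
    linarith [dist_triangle (x (k + 1)) (x k) y]

theorem tendsto_of_isolated_mapClusterPt [ProperSpace E]
    (hstep : Tendsto (fun k => dist (x (k + 1)) (x k)) atTop (𝓝 0))
    (hy : MapClusterPt y atTop x) (hiso : ∃ U ∈ 𝓝 y, ∀ z ∈ U, MapClusterPt z atTop x → z = y) :
    Tendsto x atTop (𝓝 y) := by
  obtain ⟨U, hU, hUy⟩ := hiso
  obtain ⟨η, hη, hball⟩ := Metric.mem_nhds_iff.1 hU
  refine Metric.tendsto_nhds.2 fun δ hδ => ?_
  obtain ⟨r, hr, hrmin⟩ := exists_between (show 0 < min (η / 2) δ by positivity)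
  have hrη : 2 * r < η := by linarith [hrmin.trans_le (min_le_left _ _)]
  have hrδ : r < δ := hrmin.trans_le (min_le_right _ _)
  have hcompact : IsCompact (Metric.closedBall y (2 * r) \ Metric.ball y r) :=
    (isCompact_closedBall y _).diff Metric.isOpen_ball
  have hannulus : ∀ᶠ k in atTop, x k ∉ Metric.closedBall y (2 * r) \ Metric.ball y r := by
    by_contra hfreq
    obtain ⟨z, hz, hzx⟩ := hcompact.exists_mapClusterPt_of_frequently
      ((not_eventually.1 hfreq).mono fun k hk => not_not.1 hk)
    have hzy : z = y := hUy z (hball (Metric.closedBall_subset_ball hrη hz.1)) hzx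
    exact hz.2 (hzy ▸ Metric.mem_ball_self hr)
  exact (eventually_mem_ball_of_frequently_of_notMem_annulus
    (hstep.eventually (eventually_lt_nhds hr)) hannulus
    (mapClusterPt_iff_frequently.1 hy _ (Metric.ball_mem_nhds y hr))).mono
      fun k hk => (Metric.mem_ball.1 hk).trans hrδ

theorem sq_div_le_of_le_mul_add {s s' p ρ q c D a a' δ : ℝ} (hs' : 0 ≤ s') (hρ : 0 ≤ ρ)
    (hρ1 : ρ < 1) (ha : 0 < a) (ha' : 0 < a') (hδ : 0 ≤ δ) (hδa : δ ≤ a) (h2 : a / a' ≤ 2)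
    (hq : a / a' * ρ ≤ q) (h : s' ≤ ρ * s + (c * a * p + D * δ)) :
    s' ^ 2 / a' ≤ q * (s ^ 2 / a) + 4 * c ^ 2 / (1 - ρ) * a ^ 2 * (p ^ 2 / a)
      + 4 * D ^ 2 / (1 - ρ) * δ := by
  have hρ' : 0 < 1 - ρ := sub_pos.2 hρ1
  set e := c * a * p + D * δ
  have hconvex : s' ^ 2 ≤ ρ * s ^ 2 + e ^ 2 / (1 - ρ) := by
    have hgap : ρ * s ^ 2 + e ^ 2 / (1 - ρ) - (ρ * s + e) ^ 2
        = ρ * ((1 - ρ) * s - e) ^ 2 / (1 - ρ) := by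
      field_simp
      ring
    have hgap0 : 0 ≤ ρ * ((1 - ρ) * s - e) ^ 2 / (1 - ρ) := by positivity
    linarith [pow_le_pow_left₀ hs' h 2]
  have herror : e ^ 2 / a ≤ 2 * c ^ 2 * a ^ 2 * (p ^ 2 / a) + 2 * D ^ 2 * δ := by
    rw [div_le_iff₀ ha]
    calc e ^ 2 ≤ 2 * (c * a * p) ^ 2 + 2 * D ^ 2 * (δ * δ) := by
          nlinarith [sq_nonneg (c * a * p - D * δ)]
      _ ≤ 2 * (c * a * p) ^ 2 + 2 * D ^ 2 * (δ * a) := by gcongr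
      _ = _ := by field_simp
  calc s' ^ 2 / a' ≤ (ρ * s ^ 2 + e ^ 2 / (1 - ρ)) / a' := by gcongr
    _ = a / a' * ρ * (s ^ 2 / a) + a / a' * (1 / (1 - ρ)) * (e ^ 2 / a) := by field_simp
    _ ≤ q * (s ^ 2 / a)
        + 2 * (1 / (1 - ρ)) * (2 * c ^ 2 * a ^ 2 * (p ^ 2 / a) + 2 * D ^ 2 * δ) := by gcongr
    _ = _ := by ring

end Sequences

section Averaging

variable {E : Type*} [NormedAddCommGroup E] [InnerProductSpace ℝ E]

/-- `T` averages towards the subspace `K`: it is symmetric, fixes `K` pointwise, and contracts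
the orthogonal complement of `K`. The mixing matrix of a connected network averages towards the
consensus subspace. -/
structure IsAveraging (T : E →ₗ[ℝ] E) (K : Submodule ℝ E) : Prop where
  isSymmetric : T.IsSymmetric
  map_eq : ∀ x ∈ K, T x = x
  exists_contraction : ∃ ρ : ℝ, 0 ≤ ρ ∧ ρ < 1 ∧ ∀ x ∈ Kᗮ, ‖T x‖ ≤ ρ * ‖x‖

variable {T : E →ₗ[ℝ] E} {K : Submodule ℝ E}

namespace IsAveraging

theorem map_mem_orthogonal (hT : IsAveraging T K) {x : E} (hx : x ∈ Kᗮ) : T x ∈ Kᗮ := by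
  refine (K.mem_orthogonal' _).2 fun y hy => ?_
  rw [hT.isSymmetric, hT.map_eq y hy, K.inner_left_of_mem_orthogonal hy hx]

theorem norm_map_le_of_mem (hT : IsAveraging T K) {x : E} (hx : x ∈ Kᗮ) : ‖T x‖ ≤ ‖x‖ := by
  obtain ⟨ρ, -, hρ1, hcontract⟩ := hT.exists_contraction
  exact (hcontract x hx).trans (mul_le_of_le_one_left (norm_nonneg x) hρ1.le)

theorem abs_inner_map_self_le (hT : IsAveraging T K) {x : E} (hx : x ∈ Kᗮ) :
    |inner ℝ x (T x)| ≤ ‖x‖ ^ 2 := by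
  rw [sq]
  exact (abs_real_inner_le_norm _ _).trans
    (mul_le_mul_of_nonneg_left (hT.norm_map_le_of_mem hx) (norm_nonneg x))

end IsAveraging

/-- The penalized objective `S x + ⟪x, (1 - T) x⟫ / (2 a)`, the Lyapunov function of the
iteration `x ↦ T x - a v` when `v` is a (sub)gradient of `S`. -/
def penalized (T : E →ₗ[ℝ] E) (S : E → ℝ) (a : ℝ) (x : E) : ℝ :=
  S x + inner ℝ x (x - T x) / (2 * a)

theorem penalized_le_sub (hT : T.IsSymmetric) {S : E → ℝ} {a c : ℝ} (ha : 0 < a) {y z v : E}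
    (hz : z = T y - a • v) (hS : S z ≤ S y + inner ℝ v (z - y) + c / 2 * ‖z - y‖ ^ 2) :
    penalized T S a z ≤ penalized T S a y
      - ((‖z - y‖ ^ 2 + inner ℝ (z - y) (T (z - y))) / a - c * ‖z - y‖ ^ 2) / 2 := by
  obtain ⟨d, rfl⟩ : ∃ d, z = y + d := ⟨z - y, (add_sub_cancel y z).symm⟩
  rw [add_sub_cancel_left] at hS ⊢
  have hpenalty : inner ℝ (y + d) (y + d - T (y + d)) = inner ℝ y (y - T y)
      + 2 * inner ℝ (y - T y) d + (‖d‖ ^ 2 - inner ℝ d (T d)) := by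
    simp only [map_add, inner_sub_right, inner_sub_left, inner_add_left, inner_add_right,
      real_inner_self_eq_norm_sq, real_inner_comm y d, real_inner_comm (T y) d]
    linear_combination hT y d
  have hdirection : inner ℝ (y - T y) d = -(a * inner ℝ v d) - ‖d‖ ^ 2 := by
    have hres : y - T y = -(a • v) - d := by
      rw [← sub_eq_zero, ← sub_eq_zero.2 hz]
      abel
    rw [hres, inner_sub_left, inner_neg_left, real_inner_smul_left, real_inner_self_eq_norm_sq]
  unfold penalized
  rw [hpenalty, hdirection]
  calc _ ≤ S y + inner ℝ v d + c / 2 * ‖d‖ ^ 2 + (inner ℝ y (y - T y)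
        + 2 * (-(a * inner ℝ v d) - ‖d‖ ^ 2) + (‖d‖ ^ 2 - inner ℝ d (T d))) / (2 * a) := by gcongr
    _ = _ := by field_simp; ring

namespace IsAveraging

variable [K.HasOrthogonalProjection]

theorem map_eq_add (hT : IsAveraging T K) (x : E) :
    T x = K.starProjection x + T (Kᗮ.starProjection x) := by
  conv_lhs => rw [← K.starProjection_add_starProjection_orthogonal x]
  rw [map_add, hT.map_eq _ (K.starProjection_apply_mem x)]

theorem starProjection_map (hT : IsAveraging T K) (x : E) :
    K.starProjection (T x) = K.starProjection x := by
  have horth : T (Kᗮ.starProjection x) ∈ Kᗮ :=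
    hT.map_mem_orthogonal (Kᗮ.starProjection_apply_mem x)
  rw [hT.map_eq_add, map_add, K.starProjection_apply_eq_zero_iff.2 horth, add_zero,
    K.starProjection_eq_self_iff.2 (K.starProjection_apply_mem x)]

theorem starProjection_orthogonal_map (hT : IsAveraging T K) (x : E) :
    Kᗮ.starProjection (T x) = T (Kᗮ.starProjection x) := by
  rw [K.starProjection_orthogonal_val, hT.starProjection_map, hT.map_eq_add, add_sub_cancel_left]

theorem map_sub_self (hT : IsAveraging T K) (x : E) :
    T x - x = T (Kᗮ.starProjection x) - Kᗮ.starProjection x := by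
  rw [hT.map_eq_add, K.starProjection_orthogonal_val x]
  abel

theorem norm_map_le (hT : IsAveraging T K) (x : E) : ‖T x‖ ≤ ‖x‖ := by
  refine le_of_sq_le_sq ?_ (norm_nonneg x)
  rw [K.norm_sq_eq_add_norm_sq_starProjection (T x), K.norm_sq_eq_add_norm_sq_starProjection x,
    hT.starProjection_map, hT.starProjection_orthogonal_map]
  gcongr
  exact hT.norm_map_le_of_mem (Kᗮ.starProjection_apply_mem x)

theorem inner_map_self (hT : IsAveraging T K) (x : E) :
    inner ℝ x (T x) = ‖K.starProjection x‖ ^ 2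
      + inner ℝ (Kᗮ.starProjection x) (T (Kᗮ.starProjection x)) := by
  have hP := K.starProjection_apply_mem x
  have hQ := Kᗮ.starProjection_apply_mem x
  conv_lhs => rw [hT.map_eq_add, ← K.starProjection_add_starProjection_orthogonal x]
  simp only [map_add, K.starProjection_eq_self_iff.2 hP, inner_add_left, inner_add_right,
    Kᗮ.starProjection_eq_self_iff.2 hQ, K.starProjection_apply_eq_zero_iff.2 hQ,
    Kᗮ.starProjection_apply_eq_zero_iff.2 (K.le_orthogonal_orthogonal hP), zero_add, add_zero,
    K.inner_left_of_mem_orthogonal hP hQ,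
    K.inner_right_of_mem_orthogonal hP (hT.map_mem_orthogonal hQ), real_inner_self_eq_norm_sq]

theorem norm_sq_sub_norm_sq_le_inner_map (hT : IsAveraging T K) (x : E) :
    ‖K.starProjection x‖ ^ 2 - ‖Kᗮ.starProjection x‖ ^ 2 ≤ inner ℝ x (T x) := by
  rw [hT.inner_map_self]
  linarith [neg_le_of_abs_le (hT.abs_inner_map_self_le (Kᗮ.starProjection_apply_mem x))]

theorem inner_sub_map_nonneg (hT : IsAveraging T K) (x : E) : 0 ≤ inner ℝ x (x - T x) := by
  rw [inner_sub_right, real_inner_self_eq_norm_sq, hT.inner_map_self,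
    K.norm_sq_eq_add_norm_sq_starProjection x]
  linarith [le_of_abs_le (hT.abs_inner_map_self_le (Kᗮ.starProjection_apply_mem x))]

theorem inner_sub_map_le (hT : IsAveraging T K) (x : E) :
    inner ℝ x (x - T x) ≤ 2 * ‖Kᗮ.starProjection x‖ ^ 2 := by
  rw [inner_sub_right, real_inner_self_eq_norm_sq, K.norm_sq_eq_add_norm_sq_starProjection x]
  linarith [hT.norm_sq_sub_norm_sq_le_inner_map x]

end IsAveraging

end Averaging

section PerturbedConsensus

variable {E : Type*} [NormedAddCommGroup E] [InnerProductSpace ℝ E]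

/-- The iteration `x (k + 1) = T (x k) - α k • v k`: an averaging step towards `K`, perturbed by
bounded directions `v k` with vanishing step sizes. -/
structure IsPerturbedConsensus (T : E →ₗ[ℝ] E) (K : Submodule ℝ E) (α : ℕ → ℝ) (x v : ℕ → E) :
    Prop where
  averaging : IsAveraging T K
  step : IsVanishingStep α
  succ_eq : ∀ k, x (k + 1) = T (x k) - α k • v k
  bounded : ∃ D, ∀ k, ‖v k‖ ≤ D

namespace IsPerturbedConsensus

variable {T : E →ₗ[ℝ] E} {K : Submodule ℝ E} {α : ℕ → ℝ} {x v : ℕ → E}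

theorem smul_isBigO (h : IsPerturbedConsensus T K α x v) : (fun k => α k • v k) =O[atTop] α := by
  obtain ⟨D, hD⟩ := h.bounded
  refine IsBigO.of_bound D (Eventually.of_forall fun k => ?_)
  rw [norm_smul, mul_comm]
  gcongr
  exact hD k

theorem penalized_succ_le (h : IsPerturbedConsensus T K α x v) {S : E → ℝ} {L θ : ℝ} {k : ℕ}
    (hS : S (x (k + 1)) ≤ S (x k) + inner ℝ (v k) (x (k + 1) - x k)
      + (L + θ / α k) / 2 * ‖x (k + 1) - x k‖ ^ 2) :
    penalized T S (α k) (x (k + 1)) ≤ penalized T S (α k) (x k)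
      - (((1 - θ) * ‖x (k + 1) - x k‖ ^ 2 + inner ℝ (x (k + 1) - x k) (T (x (k + 1) - x k))) / α k
        - L * ‖x (k + 1) - x k‖ ^ 2) / 2 :=
  (penalized_le_sub h.averaging.isSymmetric (h.step.pos k) (h.succ_eq k) hS).trans_eq (by ring)

theorem increment_succ (h : IsPerturbedConsensus T K α x v) (k : ℕ) :
    x (k + 2) - x (k + 1) = T (x (k + 1) - x k) - α (k + 1) • (v (k + 1) - v k)
      + (α k - α (k + 1)) • v k := by
  rw [h.succ_eq (k + 1), map_sub]
  nth_rw 2 [h.succ_eq k]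
  module

theorem norm_sub_smul_le (h : IsPerturbedConsensus T K α x v) {D : ℝ} (hD : ∀ k, ‖v k‖ ≤ D)
    (k : ℕ) : ‖(α k - α (k + 1)) • v k‖ ≤ D * (α k - α (k + 1)) := by
  have hδ := sub_nonneg.2 (h.step.succ_le k)
  rw [norm_smul, Real.norm_of_nonneg hδ, mul_comm]
  exact mul_le_mul_of_nonneg_right (hD k) hδ

variable [K.HasOrthogonalProjection]

theorem starProjection_succ (h : IsPerturbedConsensus T K α x v) (k : ℕ) :
    K.starProjection (x (k + 1)) = K.starProjection (x k) - α k • K.starProjection (v k) := by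
  rw [h.succ_eq, map_sub, map_smul, h.averaging.starProjection_map]

theorem disagreement_isBigO (h : IsPerturbedConsensus T K α x v) :
    (fun k => Kᗮ.starProjection (x k)) =O[atTop] α := by
  obtain ⟨ρ, hρ, hρ1, hcontract⟩ := h.averaging.exists_contraction
  obtain ⟨D, hD⟩ := h.bounded
  refine h.step.isBigO_of_le_contraction hρ hρ1 ((norm_nonneg _).trans (hD 0)) fun k => ?_
  rw [h.succ_eq, map_sub, h.averaging.starProjection_orthogonal_map]
  refine (norm_sub_le _ _).trans (add_le_add (hcontract _ (Kᗮ.starProjection_apply_mem _)) ?_)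
  refine (Kᗮ.norm_starProjection_apply_le _).trans ?_
  rw [norm_smul, Real.norm_of_nonneg (h.step.pos k).le, mul_comm]
  exact mul_le_mul_of_nonneg_right (hD k) (h.step.pos k).le

theorem increment_isBigO (h : IsPerturbedConsensus T K α x v) :
    (fun k => x (k + 1) - x k) =O[atTop] α := by
  have hT : (fun k => T (Kᗮ.starProjection (x k))) =O[atTop] α :=
    (IsBigO.of_norm_le fun k => h.averaging.norm_map_le _).trans h.disagreement_isBigO.norm_left
  refine ((hT.sub h.disagreement_isBigO).sub h.smul_isBigO).congr_left fun k => ?_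
  rw [← h.averaging.map_sub_self, h.succ_eq]
  abel

theorem exists_inner_sub_map_le (h : IsPerturbedConsensus T K α x v) :
    ∃ C, 0 ≤ C ∧ ∀ k, inner ℝ (x k) (x k - T (x k)) ≤ 2 * C * α k ^ 2 := by
  obtain ⟨C, -, hC⟩ := h.step.exists_forall_norm_le_mul h.disagreement_isBigO
  refine ⟨C ^ 2, sq_nonneg C, fun k => (h.averaging.inner_sub_map_le _).trans ?_⟩
  rw [mul_assoc, ← mul_pow]
  gcongr
  exact hC k

theorem tendsto_penalty_div (h : IsPerturbedConsensus T K α x v) :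
    Tendsto (fun k => inner ℝ (x k) (x k - T (x k)) / (2 * α k)) atTop (𝓝 0) := by
  obtain ⟨C, -, hC⟩ := h.exists_inner_sub_map_le
  refine squeeze_zero (g := fun k => C * α k) (fun k => ?_) (fun k => ?_)
    (by simpa using h.step.tendsto_zero.const_mul C)
  · exact div_nonneg (h.averaging.inner_sub_map_nonneg _) (mul_nonneg zero_le_two (h.step.pos k).le)
  · rw [div_le_iff₀ (mul_pos two_pos (h.step.pos k))]
    exact (hC k).trans_eq (by ring)

theorem exists_penalized_change_le (h : IsPerturbedConsensus T K α x v) (S : E → ℝ) :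
    ∃ C, ∀ k, penalized T S (α (k + 1)) (x (k + 1)) ≤
      penalized T S (α k) (x (k + 1)) + C * (α k - α (k + 1)) := by
  obtain ⟨C, hC, hpenalty⟩ := h.exists_inner_sub_map_le
  refine ⟨C, fun k => ?_⟩
  have hpos := h.step.pos k
  have hpos' := h.step.pos (k + 1)
  have hsucc := h.step.succ_le k
  set Q := inner ℝ (x (k + 1)) (x (k + 1) - T (x (k + 1)))
  have hQ : Q ≤ C * (2 * (α k * α (k + 1))) :=
    calc Q ≤ 2 * C * α (k + 1) ^ 2 := hpenalty (k + 1)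
      _ = C * (2 * (α (k + 1) * α (k + 1))) := by ring
      _ ≤ C * (2 * (α k * α (k + 1))) := by gcongr
  have hchange : Q / (2 * α (k + 1)) - Q / (2 * α k)
      = Q / (2 * (α k * α (k + 1))) * (α k - α (k + 1)) := by field_simp
  have hle : Q / (2 * (α k * α (k + 1))) * (α k - α (k + 1)) ≤ C * (α k - α (k + 1)) :=
    mul_le_mul_of_nonneg_right ((div_le_iff₀ (by positivity)).2 hQ) (sub_nonneg.2 hsucc)
  unfold penalized
  linarith

theorem le_penalized (h : IsPerturbedConsensus T K α x v) (S : E → ℝ) (k : ℕ) (y : E) :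
    S y ≤ penalized T S (α k) y :=
  le_add_of_nonneg_right
    (div_nonneg (h.averaging.inner_sub_map_nonneg y) (mul_nonneg zero_le_two (h.step.pos k).le))

theorem tendsto_penalized_and_summable (h : IsPerturbedConsensus T K α x v) {S : E → ℝ}
    {L θ μ b : ℝ}
    (hS : ∀ k, S (x (k + 1)) ≤ S (x k) + inner ℝ (v k) (x (k + 1) - x k)
      + (L + θ / α k) / 2 * ‖x (k + 1) - x k‖ ^ 2)
    (hb : ∀ k, b ≤ S (x k)) (hμ : ∀ y, μ * ‖y‖ ^ 2 ≤ inner ℝ y (T y)) (hθ : θ < 1 + μ) :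
    (∃ l, Tendsto (fun k => penalized T S (α k) (x k)) atTop (𝓝 l) ∧
      Tendsto (fun k => S (x k)) atTop (𝓝 l)) ∧
    Summable fun k => ((α k)⁻¹ * (1 + μ - θ) - L) * ‖x (k + 1) - x k‖ ^ 2 := by
  obtain ⟨C, hC⟩ := h.exists_penalized_change_le S
  have hdescent : ∀ k, penalized T S (α (k + 1)) (x (k + 1)) ≤ penalized T S (α k) (x k)
      - ((α k)⁻¹ * (1 + μ - θ) - L) * ‖x (k + 1) - x k‖ ^ 2 / 2 + C * (α k - α (k + 1)) :=
    fun k => by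
    have := h.step.pos k
    have hdir := hμ (x (k + 1) - x k)
    calc _ ≤ _ := (hC k).trans (add_le_add_left (h.penalized_succ_le (hS k)) _)
      _ ≤ penalized T S (α k) (x k) - (((1 - θ) * ‖x (k + 1) - x k‖ ^ 2
          + μ * ‖x (k + 1) - x k‖ ^ 2) / α k - L * ‖x (k + 1) - x k‖ ^ 2) / 2
          + C * (α k - α (k + 1)) := by gcongr
      _ = _ := by ring
  have hcoef : ∀ᶠ k in atTop, 0 ≤ ((α k)⁻¹ * (1 + μ - θ) - L) * ‖x (k + 1) - x k‖ ^ 2 / 2 := by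
    filter_upwards [(h.step.tendsto_inv.atTop_mul_const (sub_pos.2 hθ)).eventually_ge_atTop L]
      with k hk
    exact div_nonneg (mul_nonneg (sub_nonneg.2 hk) (sq_nonneg _)) zero_le_two
  obtain ⟨⟨l, hl⟩, hsum⟩ := tendsto_and_summable_of_eventually_le_sub_add
    (V := fun k => penalized T S (α k) (x k)) (fun k => (hb k).trans (h.le_penalized S k (x k)))
    (Eventually.of_forall hdescent) hcoef (h.step.summable_sub.mul_left C)
  refine ⟨⟨l, hl, ?_⟩, (hsum.mul_left 2).congr fun k => mul_div_cancel₀ _ two_ne_zero⟩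
  simpa [penalized] using hl.sub h.tendsto_penalty_div

theorem starProjection_increment (h : IsPerturbedConsensus T K α x v) (k : ℕ) :
    K.starProjection (x (k + 1) - x k) = -(α k • K.starProjection (v k)) := by
  rw [map_sub, h.starProjection_succ, sub_sub_cancel_left]

theorem norm_smul_sub_le (h : IsPerturbedConsensus T K α x v) {A D : ℝ} (hA : 0 ≤ A)
    (hD : ∀ k, ‖v k‖ ≤ D) {k : ℕ} (hsmall : A * α (k + 1) ≤ 1 / 2)
    (hslow : ‖v (k + 1) - v k‖ ≤ A * (‖x (k + 1) - x k‖ + ‖x (k + 2) - x (k + 1)‖)) :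
    ‖α (k + 1) • (v (k + 1) - v k)‖ ≤
      4 * A * α k * ‖x (k + 1) - x k‖ + D * (α k - α (k + 1)) := by
  set d := x (k + 1) - x k
  set d' := x (k + 2) - x (k + 1) with hd'
  set w := v (k + 1) - v k
  have hpos := h.step.pos (k + 1)
  have hδ := (norm_nonneg _).trans (h.norm_sub_smul_le hD k)
  have hw : ‖α (k + 1) • w‖ ≤ A * α (k + 1) * (‖d‖ + ‖d'‖) := by
    rw [norm_smul, Real.norm_of_nonneg hpos.le, mul_comm A, mul_assoc]
    gcongr
  have hd'le : ‖d'‖ ≤ ‖d‖ + ‖α (k + 1) • w‖ + D * (α k - α (k + 1)) := by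
    rw [hd', h.increment_succ]
    exact (norm_add_le _ _).trans (add_le_add ((norm_sub_le _ _).trans
      (add_le_add_left (h.averaging.norm_map_le d) _)) (h.norm_sub_smul_le hD k))
  have hd'3 : ‖d'‖ ≤ 3 * ‖d‖ + 2 * (D * (α k - α (k + 1))) := by
    have : A * α (k + 1) * (‖d‖ + ‖d'‖) ≤ 1 / 2 * (‖d‖ + ‖d'‖) := by gcongr
    linarith
  calc ‖α (k + 1) • w‖ ≤ A * α (k + 1) * (‖d‖ + ‖d'‖) := hw
    _ ≤ A * α (k + 1) * (‖d‖ + (3 * ‖d‖ + 2 * (D * (α k - α (k + 1))))) := by gcongr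
    _ = 4 * A * α (k + 1) * ‖d‖ + A * α (k + 1) * (2 * (D * (α k - α (k + 1)))) := by ring
    _ ≤ 4 * A * α k * ‖d‖ + 1 / 2 * (2 * (D * (α k - α (k + 1)))) := by
      gcongr
      exact h.step.succ_le k
    _ = _ := by ring

theorem norm_disagreement_increment_succ_le (h : IsPerturbedConsensus T K α x v) {ρ A D : ℝ}
    (hρ : ∀ y ∈ Kᗮ, ‖T y‖ ≤ ρ * ‖y‖) (hA : 0 ≤ A) (hD : ∀ k, ‖v k‖ ≤ D) {k : ℕ}
    (hsmall : A * α (k + 1) ≤ 1 / 2)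
    (hslow : ‖v (k + 1) - v k‖ ≤ A * (‖x (k + 1) - x k‖ + ‖x (k + 2) - x (k + 1)‖)) :
    ‖Kᗮ.starProjection (x (k + 2) - x (k + 1))‖ ≤
      (ρ + 4 * A * α k) * ‖Kᗮ.starProjection (x (k + 1) - x k)‖
        + (4 * A * α k * ‖K.starProjection (x (k + 1) - x k)‖ + 2 * D * (α k - α (k + 1))) := by
  set d := x (k + 1) - x k
  have hd : ‖d‖ ≤ ‖K.starProjection d‖ + ‖Kᗮ.starProjection d‖ := by
    conv_lhs => rw [← K.starProjection_add_starProjection_orthogonal d]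
    exact norm_add_le _ _
  have hpos := h.step.pos k
  rw [h.increment_succ, map_add, map_sub, h.averaging.starProjection_orthogonal_map]
  calc _ ≤ ‖T (Kᗮ.starProjection d)‖ + ‖Kᗮ.starProjection (α (k + 1) • (v (k + 1) - v k))‖
        + ‖Kᗮ.starProjection ((α k - α (k + 1)) • v k)‖ :=
        (norm_add_le _ _).trans (add_le_add_left (norm_sub_le _ _) _)
    _ ≤ ρ * ‖Kᗮ.starProjection d‖ + (4 * A * α k * ‖d‖ + D * (α k - α (k + 1)))
        + D * (α k - α (k + 1)) := by
      gcongr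
      · exact hρ _ (Kᗮ.starProjection_apply_mem d)
      · exact (Kᗮ.norm_starProjection_apply_le _).trans (h.norm_smul_sub_le hA hD hsmall hslow)
      · exact (Kᗮ.norm_starProjection_apply_le _).trans (h.norm_sub_smul_le hD k)
    _ ≤ ρ * ‖Kᗮ.starProjection d‖ + (4 * A * α k * (‖K.starProjection d‖
        + ‖Kᗮ.starProjection d‖) + D * (α k - α (k + 1))) + D * (α k - α (k + 1)) := by gcongr
    _ = _ := by ring

theorem exists_disagreement_increment_contraction (h : IsPerturbedConsensus T K α x v) {A : ℝ}
    (hA : 0 ≤ A) (hslow : ∀ᶠ k in atTop,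
      ‖v (k + 1) - v k‖ ≤ A * (‖x (k + 1) - x k‖ + ‖x (k + 2) - x (k + 1)‖)) :
    ∃ q B C : ℝ, q < 1 ∧ ∀ᶠ k in atTop,
      ‖Kᗮ.starProjection (x (k + 2) - x (k + 1))‖ ^ 2 / α (k + 1) ≤
        q * (‖Kᗮ.starProjection (x (k + 1) - x k)‖ ^ 2 / α k)
          + B * α k ^ 2 * (‖K.starProjection (x (k + 1) - x k)‖ ^ 2 / α k)
          + C * (α k - α (k + 1)) := by
  obtain ⟨D, hD⟩ := h.bounded
  obtain ⟨ρ, hρ, hρ1, hcontract⟩ := h.averaging.exists_contraction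
  obtain ⟨ρ', hρρ', hρ'1⟩ := exists_between hρ1
  obtain ⟨q, hρ'q, hq1⟩ := exists_between hρ'1
  refine ⟨q, 4 * (4 * A) ^ 2 / (1 - ρ'), 4 * (2 * D) ^ 2 / (1 - ρ'), hq1, ?_⟩
  filter_upwards [hslow, h.step.eventually_mul_lt A (show (0 : ℝ) < 1 / 2 by norm_num),
    h.step.eventually_mul_lt (4 * A) (sub_pos.2 hρρ'), h.step.eventually_ratio_mul_lt one_lt_two,
    h.step.eventually_ratio_mul_lt hρ'q] with k hslow_k hA_half hA_gap htwo hq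
  have hpos' := h.step.pos (k + 1)
  have hδ := sub_nonneg.2 (h.step.succ_le k)
  have hsmall : A * α (k + 1) ≤ 1 / 2 :=
    (mul_le_mul_of_nonneg_left (h.step.succ_le k) hA).trans hA_half.le
  refine sq_div_le_of_le_mul_add (norm_nonneg _) (hρ.trans hρρ'.le) hρ'1 (h.step.pos k) hpos'
    hδ (sub_le_self _ hpos'.le) (by simpa using htwo.le) hq.le
    ((h.norm_disagreement_increment_succ_le hcontract hA hD hsmall hslow_k).trans ?_)
  gcongr
  linarith

theorem exists_penalized_le_sub_projections (h : IsPerturbedConsensus T K α x v) {S : E → ℝ}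
    {L : ℝ} (hS : ∀ k, S (x (k + 1)) ≤ S (x k) + inner ℝ (v k) (x (k + 1) - x k)
      + (L + 1 / α k) / 2 * ‖x (k + 1) - x k‖ ^ 2) :
    ∃ C, ∀ᶠ k in atTop, penalized T S (α (k + 1)) (x (k + 1)) ≤ penalized T S (α k) (x k)
      - 1 / 4 * (‖K.starProjection (x (k + 1) - x k)‖ ^ 2 / α k)
      + ‖Kᗮ.starProjection (x (k + 1) - x k)‖ ^ 2 / α k + C * (α k - α (k + 1)) := by
  obtain ⟨C, hC⟩ := h.exists_penalized_change_le S
  refine ⟨C, ?_⟩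
  filter_upwards [h.step.eventually_mul_lt L (show (0 : ℝ) < 1 / 2 by norm_num)] with k hk
  have hpos := h.step.pos k
  set d := x (k + 1) - x k
  have hdecrease : (‖K.starProjection d‖ ^ 2 - ‖Kᗮ.starProjection d‖ ^ 2) / α k
      - 1 / 2 * ((‖K.starProjection d‖ ^ 2 + ‖Kᗮ.starProjection d‖ ^ 2) / α k)
      ≤ inner ℝ d (T d) / α k - L * ‖d‖ ^ 2 := by
    have hL : L * ‖d‖ ^ 2 = L * α k * (‖d‖ ^ 2 / α k) := by field_simp
    rw [hL, ← K.norm_sq_eq_add_norm_sq_starProjection]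
    gcongr
    exact h.averaging.norm_sq_sub_norm_sq_le_inner_map d
  have hstep := h.penalized_succ_le (hS k)
  rw [sub_self, zero_mul, zero_add] at hstep
  have hQ : 0 ≤ ‖Kᗮ.starProjection d‖ ^ 2 / α k := by positivity
  rw [sub_div, add_div] at hdecrease
  linarith [hC k]

theorem tendsto_starProjection_zero (h : IsPerturbedConsensus T K α x v) (hdiv : ¬ Summable α)
    {S : E → ℝ} {L b A : ℝ} (hS : ∀ k, S (x (k + 1)) ≤ S (x k) + inner ℝ (v k) (x (k + 1) - x k)
      + (L + 1 / α k) / 2 * ‖x (k + 1) - x k‖ ^ 2)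
    (hb : ∀ k, b ≤ S (x k)) (hA : 0 ≤ A) (hslow : ∀ᶠ k in atTop,
      ‖v (k + 1) - v k‖ ≤ A * (‖x (k + 1) - x k‖ + ‖x (k + 2) - x (k + 1)‖)) :
    Tendsto (fun k => K.starProjection (v k)) atTop (𝓝 0) := by
  obtain ⟨q, B, C, hq, hcontract⟩ := h.exists_disagreement_increment_contraction hA hslow
  obtain ⟨C', hdescent⟩ := h.exists_penalized_le_sub_projections hS
  have hα2 : Tendsto (fun k => B * α k ^ 2) atTop (𝓝 0) := by
    simpa using (h.step.tendsto_zero.pow 2).const_mul B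
  have hsum : Summable fun k => ‖K.starProjection (x (k + 1) - x k)‖ ^ 2 / α k :=
    summable_of_coupled_descent (V := fun k => penalized T S (α k) (x k))
      (a := fun k => ‖Kᗮ.starProjection (x (k + 1) - x k)‖ ^ 2 / α k)
      (fun k => (hb k).trans (h.le_penalized S k (x k)))
      (fun k => div_nonneg (sq_nonneg _) (h.step.pos k).le)
      (fun k => div_nonneg (sq_nonneg _) (h.step.pos k).le) (by norm_num) hq hdescent hcontract
      hα2 (h.step.summable_sub.mul_left C') (h.step.summable_sub.mul_left C)
  refine h.step.tendsto_zero_of_summable_mul_sq hdiv (hsum.congr fun k => ?_) ?_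
  · have hpos := h.step.pos k
    rw [h.starProjection_increment, norm_neg, norm_smul, Real.norm_of_nonneg hpos.le]
    field_simp
  · have hv : (fun k => v (k + 1) - v k) =O[atTop]
        fun k => ‖x (k + 1) - x k‖ + ‖x (k + 2) - x (k + 1)‖ :=
      IsBigO.of_bound A (hslow.mono fun k hk => by rwa [Real.norm_of_nonneg (by positivity)])
    have hinc' : (fun k => x (k + 2) - x (k + 1)) =O[atTop] α :=
      (h.increment_isBigO.comp_tendsto (tendsto_add_atTop_nat 1)).trans h.step.isBigO_succ
    refine .trans (.of_norm_le fun k => ?_)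
      (hv.trans (h.increment_isBigO.norm_left.add hinc'.norm_left)).norm_left
    rw [← map_sub]
    exact K.norm_starProjection_apply_le _

theorem norm_starProjection_succ_sub_sq (h : IsPerturbedConsensus T K α x v) {y : E} (hy : y ∈ K)
    (k : ℕ) : ‖K.starProjection (x (k + 1)) - y‖ ^ 2 = ‖K.starProjection (x k) - y‖ ^ 2
      - 2 * α k * inner ℝ (v k) (K.starProjection (x k) - y)
      + α k ^ 2 * ‖K.starProjection (v k)‖ ^ 2 := by
  have hmem : K.starProjection (x k) - y ∈ K := K.sub_mem (K.starProjection_apply_mem _) hy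
  have hadjoint : inner ℝ (K.starProjection (v k)) (K.starProjection (x k) - y)
      = inner ℝ (v k) (K.starProjection (x k) - y) := by
    rw [K.inner_starProjection_left_eq_right, K.starProjection_eq_self_iff.2 hmem]
  rw [h.starProjection_succ, sub_right_comm, norm_sub_sq_real, norm_smul,
    Real.norm_of_nonneg (h.step.pos k).le, inner_smul_right, real_inner_comm, hadjoint]
  ring

theorem exists_smul_sub_le (h : IsPerturbedConsensus T K α x v) {S : E → ℝ} {Λ : NNReal}
    (hΛ : LipschitzWith Λ S) {y : E} (hy : y ∈ K) {c : ℝ}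
    (hS : ∀ k, S (x k) + inner ℝ (v k) (y - x k) ≤ S y + c * α k) :
    ∃ C, ∀ k, α k * (S (K.starProjection (x (k + 1))) - S y) ≤
      (‖K.starProjection (x k) - y‖ ^ 2 - ‖K.starProjection (x (k + 1)) - y‖ ^ 2) / 2
        + C * α k ^ 2 := by
  obtain ⟨D, hD⟩ := h.bounded
  have hD0 : 0 ≤ D := (norm_nonneg _).trans (hD 0)
  obtain ⟨A, -, hdis⟩ := h.step.exists_forall_norm_le_mul h.disagreement_isBigO
  obtain ⟨B, -, hdrift⟩ := h.step.exists_forall_norm_le_mul <| h.increment_isBigO.sub <|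
    (h.disagreement_isBigO.comp_tendsto (tendsto_add_atTop_nat 1)).trans h.step.isBigO_succ
  refine ⟨D ^ 2 / 2 + D * A + Λ * B + c, fun k => ?_⟩
  have hpos := h.step.pos k
  have hlip : S (K.starProjection (x (k + 1))) ≤ S (x k) + Λ * (B * α k) := by
    refine (hΛ.le_add_mul _ _).trans (add_le_add_right (mul_le_mul_of_nonneg_left ?_ Λ.2) _)
    rw [dist_eq_norm]
    refine le_of_eq_of_le (congrArg _ ?_) (hdrift k)
    simp only [Function.comp_apply, K.starProjection_orthogonal_val]
    abel
  have hproj : inner ℝ (v k) (x k - y) ≤ inner ℝ (v k) (K.starProjection (x k) - y)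
      + D * (A * α k) := by
    have hcross : inner ℝ (v k) (Kᗮ.starProjection (x k)) ≤ D * (A * α k) :=
      (real_inner_le_norm _ _).trans (mul_le_mul (hD k) (hdis k) (norm_nonneg _) hD0)
    rw [← sub_add_sub_cancel (x k) (K.starProjection (x k)) y, inner_add_right,
      ← K.starProjection_orthogonal_val]
    linarith
  have hgap : S (K.starProjection (x (k + 1))) - S y
      ≤ inner ℝ (v k) (K.starProjection (x k) - y) + (D * A + Λ * B + c) * α k := by
    have hS_k := hS k
    rw [← neg_sub, inner_neg_right] at hS_k
    linarith
  have hnorm : ‖K.starProjection (v k)‖ ^ 2 ≤ D ^ 2 := by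
    gcongr
    exact (K.norm_starProjection_apply_le _).trans (hD k)
  rw [h.norm_starProjection_succ_sub_sq hy]
  linarith [mul_le_mul_of_nonneg_left hgap hpos.le,
    mul_le_mul_of_nonneg_left hnorm (sq_nonneg (α k))]

theorem exists_sum_smul_sub_le (h : IsPerturbedConsensus T K α x v) {S : E → ℝ} {Λ : NNReal}
    (hΛ : LipschitzWith Λ S) {y : E} (hy : y ∈ K) {c : ℝ}
    (hS : ∀ k, S (x k) + inner ℝ (v k) (y - x k) ≤ S y + c * α k) :
    ∃ C, ∀ N, ∑ k ∈ Finset.range N, α k * (S (K.starProjection (x (k + 1))) - S y) ≤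
      C * (1 + ∑ k ∈ Finset.range N, α k ^ 2) := by
  obtain ⟨C, hC⟩ := h.exists_smul_sub_le hΛ hy hS
  set V : ℕ → ℝ := fun k => ‖K.starProjection (x k) - y‖ ^ 2
  refine ⟨max (V 0 / 2) C, fun N => ?_⟩
  have : 0 ≤ ∑ k ∈ Finset.range N, α k ^ 2 := Finset.sum_nonneg fun k _ => sq_nonneg _
  calc _ ≤ ∑ k ∈ Finset.range N, ((V k - V (k + 1)) / 2 + C * α k ^ 2) :=
        Finset.sum_le_sum fun k _ => hC k
    _ = (V 0 - V N) / 2 + C * ∑ k ∈ Finset.range N, α k ^ 2 := by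
      rw [Finset.sum_add_distrib, ← Finset.sum_div, Finset.sum_range_sub', ← Finset.mul_sum]
    _ ≤ V 0 / 2 + C * ∑ k ∈ Finset.range N, α k ^ 2 := by
      gcongr
      exact sub_le_self _ (sq_nonneg _)
    _ ≤ max (V 0 / 2) C * 1 + max (V 0 / 2) C * ∑ k ∈ Finset.range N, α k ^ 2 := by
      rw [mul_one]
      gcongr
      exacts [le_max_left _ _, le_max_right _ _]
    _ = _ := by ring

end IsPerturbedConsensus

end PerturbedConsensus

section ProximalSubgradients

variable {E : Type*} [NormedAddCommGroup E] [InnerProductSpace ℝ E]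

/-- `w` is a proximal subgradient of `h` at `z`, globally and with quadratic constant `c`: the
optimality condition of a proximal step, and what a gradient satisfies when it is Lipschitz. -/
def IsProximalSubgradient (h : E → ℝ) (c : ℝ) (z w : E) : Prop :=
  ∀ u, h z + inner ℝ w (u - z) - c * ‖u - z‖ ^ 2 ≤ h u

theorem le_of_forall_sub_mul_le {a b c : ℝ} (h : ∀ t ∈ Set.Ioo (0 : ℝ) 1, a - t * c ≤ b) :
    a ≤ b := by
  have hlim : Tendsto (fun t : ℝ => a - t * c) (𝓝[>] 0) (𝓝 a) := by
    have hcont : Continuous fun t : ℝ => a - t * c := by fun_prop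
    simpa using (hcont.tendsto 0).mono_left (nhdsWithin_le_nhds (s := Set.Ioi 0))
  exact le_of_tendsto hlim (mem_of_superset (Ioo_mem_nhdsGT one_pos) h)

theorem mem_frechetSubdiff_of_quadratic_le {h : E → EReal} {x w : E} {c : ℝ} (htop : h x ≠ ⊤)
    (hbot : h x ≠ ⊥)
    (hw : ∀ u, h x + ((inner ℝ w (u - x) - c * ‖u - x‖ ^ 2 : ℝ) : EReal) ≤ h u) :
    w ∈ frechetSubdiff h x := by
  refine ⟨htop, hbot, fun δ hδ => ?_⟩
  have hlim : Tendsto (fun u => c * ‖u - x‖) (𝓝 x) (𝓝 0) := by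
    have hcont : Continuous fun u => c * ‖u - x‖ := by fun_prop
    simpa using hcont.tendsto x
  filter_upwards [hlim.eventually (eventually_le_nhds hδ)] with u hu
  refine (add_le_add_right (EReal.coe_le_coe_iff.2 ?_) _).trans (hw u)
  rw [sq, ← mul_assoc]
  gcongr

theorem frechetSubdiff_subset_subdiff (h : E → EReal) (x : E) :
    frechetSubdiff h x ⊆ subdiff h x := fun w hw =>
  ⟨hw.1, hw.2.1, fun _ => x, fun _ => w, tendsto_const_nhds, tendsto_const_nhds, fun _ => hw,
    tendsto_const_nhds⟩

theorem convexOn_of_isConvexFun {h : E → ℝ} (hc : IsConvexFun fun u => (h u : EReal)) :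
    ConvexOn ℝ Set.univ h := by
  refine ⟨convex_univ, fun u _ v _ a b ha hb hab => ?_⟩
  simpa using hc (show (u, h u) ∈ {q : E × ℝ | (h q.1 : EReal) ≤ q.2} from le_refl (h u : EReal))
    (show (v, h v) ∈ {q : E × ℝ | (h q.1 : EReal) ≤ q.2} from le_refl (h v : EReal)) ha hb hab

theorem isProximalSubgradient_of_mem_prox {h : E → ℝ} {a : ℝ} (ha : 0 < a) {y z w : E}
    (hz : z ∈ prox a (fun u => (h u : EReal)) y) (hw : z + a • w = y) :
    IsProximalSubgradient h (1 / (2 * a)) z w := by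
  intro u
  have hmin : a * h z + ‖z - y‖ ^ 2 / 2 ≤ a * h u + ‖u - y‖ ^ 2 / 2 := by
    simpa only [← EReal.coe_mul, ← EReal.coe_add, EReal.coe_le_coe_iff] using hz u
  have hexpand : ‖u - y‖ ^ 2 = ‖u - z‖ ^ 2 - 2 * a * inner ℝ w (u - z) + ‖z - y‖ ^ 2 := by
    rw [← hw, ← sub_sub u, norm_sub_sq_real, sub_add_cancel_left, norm_neg, inner_smul_right,
      real_inner_comm]
    ring
  rw [hexpand] at hmin
  refine le_of_mul_le_mul_left ?_ ha
  calc a * (h z + inner ℝ w (u - z) - 1 / (2 * a) * ‖u - z‖ ^ 2)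
      = a * h z + a * inner ℝ w (u - z) - ‖u - z‖ ^ 2 / 2 := by field_simp
    _ ≤ a * h u := by linarith

theorem le_quadratic_of_lipschitz_gradient [CompleteSpace E] {f : E → ℝ} {g : E → E} {L : ℝ}
    (hf : ∀ x, HasGradientAt f (g x) x) (hg : ∀ u v, ‖g u - g v‖ ≤ L * ‖u - v‖) (x y : E) :
    f y ≤ f x + inner ℝ (g x) (y - x) + L / 2 * ‖y - x‖ ^ 2 := by
  obtain ⟨d, rfl⟩ : ∃ d, y = x + d := ⟨y - x, (add_sub_cancel x y).symm⟩
  rw [add_sub_cancel_left]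
  set φ : ℝ → ℝ := fun t => f (x + t • d) - (t * inner ℝ (g x) d + t ^ 2 * (L / 2 * ‖d‖ ^ 2))
  have hderiv : ∀ t, HasDerivAt φ
      (inner ℝ (g (x + t • d)) d - (inner ℝ (g x) d + 2 * t * (L / 2 * ‖d‖ ^ 2))) t := fun t => by
    have hline : HasDerivAt (fun t : ℝ => x + t • d) d t := by
      simpa using ((hasDerivAt_id t).smul_const d).const_add x
    have hcomp : HasDerivAt (fun t : ℝ => f (x + t • d)) (inner ℝ (g (x + t • d)) d) t := by
      exact (hf (x + t • d)).hasFDerivAt.comp_hasDerivAt t hline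
    refine hcomp.sub ((((hasDerivAt_id t).mul_const (inner ℝ (g x) d)).add
      ((hasDerivAt_pow 2 t).mul_const (L / 2 * ‖d‖ ^ 2))).congr_deriv ?_)
    simp only [one_mul, Nat.cast_ofNat, Nat.add_one_sub_one, pow_one]
  have hanti : AntitoneOn φ (Set.Icc 0 1) := by
    refine antitoneOn_of_deriv_nonpos (convex_Icc 0 1)
      (fun t _ => (hderiv t).continuousAt.continuousWithinAt)
      (fun t _ => (hderiv t).differentiableAt.differentiableWithinAt) fun t ht => ?_
    rw [interior_Icc] at ht
    have hgrad : ‖g (x + t • d) - g x‖ ≤ L * (t * ‖d‖) := by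
      simpa [norm_smul, abs_of_pos ht.1] using hg (x + t • d) x
    have hinner : inner ℝ (g (x + t • d) - g x) d ≤ L * (t * ‖d‖) * ‖d‖ :=
      (real_inner_le_norm _ _).trans (by gcongr)
    rw [inner_sub_left] at hinner
    rw [(hderiv t).deriv]
    linarith
  have hle : φ 1 ≤ φ 0 :=
    hanti (Set.left_mem_Icc.2 zero_le_one) (Set.right_mem_Icc.2 zero_le_one) zero_le_one
  simp only [φ, one_smul, zero_smul, add_zero, one_mul, one_pow, zero_mul, ne_eq,
    OfNat.ofNat_ne_zero, not_false_eq_true, zero_pow, sub_zero] at hle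
  linarith

theorem isProximalSubgradient_of_lipschitz_gradient [CompleteSpace E] {f : E → ℝ} {g : E → E}
    {L : ℝ} (hf : ∀ x, HasGradientAt f (g x) x) (hg : ∀ u v, ‖g u - g v‖ ≤ L * ‖u - v‖) (x : E) :
    IsProximalSubgradient f (L / 2) x (g x) := by
  intro y
  have hneg := le_quadratic_of_lipschitz_gradient (f := fun x => -f x) (g := fun x => -g x)
    (fun x => by
      rw [hasGradientAt_iff_hasFDerivAt, map_neg]
      exact (hf x).hasFDerivAt.neg)
    (fun u v => by rw [neg_sub_neg, norm_sub_rev]; exact hg u v) x y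
  rw [inner_neg_left] at hneg
  linarith

namespace IsProximalSubgradient

variable {h : E → ℝ} {c : ℝ} {z w : E}

theorem mem_frechetSubdiff (hw : IsProximalSubgradient h c z w) :
    w ∈ frechetSubdiff (fun u => (h u : EReal)) z :=
  mem_frechetSubdiff_of_quadratic_le (c := c) (EReal.coe_ne_top _) (EReal.coe_ne_bot _)
    fun u => by
      rw [← EReal.coe_add, EReal.coe_le_coe_iff, ← add_sub_assoc]
      exact hw u

theorem inner_le_of_convexOn (hw : IsProximalSubgradient h c z w) (hc : ConvexOn ℝ Set.univ h)
    (u : E) : h z + inner ℝ w (u - z) ≤ h u := by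
  refine le_of_forall_sub_mul_le (c := c * ‖u - z‖ ^ 2) fun t ht => ?_
  have hsub := hw (z + t • (u - z))
  have hconvex : h (z + t • (u - z)) ≤ (1 - t) * h z + t * h u := by
    rw [show z + t • (u - z) = (1 - t) • z + t • u by module]
    exact hc.2 (Set.mem_univ z) (Set.mem_univ u) (sub_nonneg.2 ht.2.le) ht.1.le (by ring)
  rw [add_sub_cancel_left, norm_smul, inner_smul_right, Real.norm_of_nonneg ht.1.le] at hsub
  refine le_of_mul_le_mul_left ?_ ht.1
  linarith

theorem norm_le_of_lipschitzWith (hw : IsProximalSubgradient h c z w) {M : NNReal}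
    (hM : LipschitzWith M h) : ‖w‖ ≤ M := by
  have hsq : ‖w‖ ^ 2 ≤ M * ‖w‖ := le_of_forall_sub_mul_le (c := c * ‖w‖ ^ 2) fun t ht => by
    have hsub := hw (z + t • w)
    have hlip := hM.le_add_mul (z + t • w) z
    rw [add_sub_cancel_left, norm_smul, inner_smul_right, Real.norm_of_nonneg ht.1.le,
      real_inner_self_eq_norm_sq] at hsub
    rw [dist_self_add_left, norm_smul, Real.norm_of_nonneg ht.1.le] at hlip
    refine le_of_mul_le_mul_left ?_ ht.1
    linarith
  rcases (norm_nonneg w).eq_or_lt with hzero | hpos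
  · exact hzero ▸ M.2
  · rw [sq] at hsq
    exact le_of_mul_le_mul_right hsq hpos

theorem le_inner_add (hw : IsProximalSubgradient h c z w) (u : E) :
    h z ≤ h u + inner ℝ w (z - u) + c * ‖z - u‖ ^ 2 := by
  have hsub := hw u
  rw [← neg_sub z u, inner_neg_right, norm_neg] at hsub
  linarith

end IsProximalSubgradient

end ProximalSubgradients

section BoundedSubdifferential

theorem exists_forall_le_of_tendsto_top {E : Type*} [NormedAddCommGroup E] [ProperSpace E]
    {ψ : E → EReal} (hlsc : LowerSemicontinuous ψ)
    (htop : Tendsto ψ (Bornology.cobounded E) (𝓝 ⊤)) :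
    ∃ z, ∀ u, ψ z ≤ ψ u := by
  by_cases hψ : ∀ y, ψ y = ⊤
  · exact ⟨0, fun u => (le_top.trans_eq (hψ u).symm)⟩
  obtain ⟨y, hy⟩ := not_forall.1 hψ
  have hfar := htop.eventually (lt_mem_nhds (lt_top_iff_ne_top.2 hy))
  rw [Metric.cobounded_eq_cocompact] at hfar
  obtain ⟨s, hs, hsfar⟩ := mem_cocompact.1 hfar
  obtain ⟨z, -, hz⟩ := (hlsc.lowerSemicontinuousOn _).exists_isMinOn (Set.insert_nonempty y s)
    (hs.insert y)
  refine ⟨z, fun u => ?_⟩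
  by_cases hu : u ∈ s
  · exact hz (Set.mem_insert_of_mem y hu)
  · exact (hz (Set.mem_insert y s)).trans (hsfar hu).le

theorem add_coe_le_of_add_coe_le_add_coe {a b : EReal} {s t : ℝ}
    (h : a + (s : EReal) ≤ b + (t : EReal)) : a + ((s - t : ℝ) : EReal) ≤ b := by
  rw [EReal.coe_sub, ← add_sub_assoc]
  exact EReal.sub_le_of_le_add h

theorem exists_forall_add_norm_sub_le {E : Type*} [NormedAddCommGroup E] [ProperSpace E]
    {f : E → ℝ} {r : E → EReal} {B M : NNReal} (hf : LipschitzWith B f) (hBM : B ≤ M)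
    (hlsc : LowerSemicontinuous fun u => (f u : EReal) + r u)
    (hcoer : IsCoercive fun u => (f u : EReal) + r u) (x : E) :
    ∃ z, ∀ u, r z + ((M * ‖z - x‖ : ℝ) : EReal) ≤ r u + ((M * ‖u - x‖ : ℝ) : EReal) := by
  set ψ : E → EReal := fun u => ((f u : EReal) + r u) + ((M * ‖u - x‖ - f u : ℝ) : EReal)
  have hψ : ∀ u, ψ u = r u + ((M * ‖u - x‖ : ℝ) : EReal) := fun u => by
    simp only [ψ]
    rw [add_comm (f u : EReal), add_assoc, ← EReal.coe_add, add_sub_cancel]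
  have hψlsc : LowerSemicontinuous ψ := by
    have hcont := hf.continuous
    exact hlsc.add' (continuous_coe_real_ereal.comp (by fun_prop)).lowerSemicontinuous
      fun u => EReal.continuousAt_add (.inr (EReal.coe_ne_bot _)) (.inr (EReal.coe_ne_top _))
  have hψtop : Tendsto ψ (Bornology.cobounded E) (𝓝 ⊤) := by
    rw [IsCoercive, comap_norm_atTop] at hcoer
    refine EReal.tendsto_nhds_top_iff_real.2 fun c => ?_
    filter_upwards [EReal.tendsto_nhds_top_iff_real.1 hcoer (c + f x)] with u hu
    have hlow : -f x ≤ M * ‖u - x‖ - f u := by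
      have hlip := hf.le_add_mul u x
      have hslope : (B : ℝ) * ‖u - x‖ ≤ M * ‖u - x‖ := by gcongr
      rw [dist_eq_norm] at hlip
      linarith
    calc (c : EReal) = ((c + f x : ℝ) : EReal) + ((-f x : ℝ) : EReal) := by
          rw [← EReal.coe_add, add_neg_cancel_right]
      _ < ((f u : EReal) + r u) + ((-f x : ℝ) : EReal) := EReal.add_lt_add_right_coe hu _
      _ ≤ ψ u := add_le_add_right (EReal.coe_le_coe_iff.2 hlow) _
  simpa only [hψ] using exists_forall_le_of_tendsto_top hψlsc hψtop

variable {E : Type*} [NormedAddCommGroup E] [InnerProductSpace ℝ E] {r : E → EReal}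

theorem norm_add_le_of_ne_zero {a : E} (ha : a ≠ 0) (v : E) :
    ‖a + v‖ ≤ ‖a‖ + inner ℝ a v / ‖a‖ + ‖v‖ ^ 2 / (2 * ‖a‖) := by
  have : 0 < ‖a‖ := norm_pos_iff.2 ha
  calc ‖a + v‖ ≤ (‖a‖ ^ 2 + ‖a + v‖ ^ 2) / (2 * ‖a‖) := by
        rw [le_div_iff₀ (by positivity)]
        nlinarith [sq_nonneg (‖a‖ - ‖a + v‖)]
    _ = _ := by
      rw [norm_add_sq_real]
      field_simp
      ring

-- Away from `x` the function `M * ‖· - x‖` is smooth, so a minimizer of `r + M * ‖· - x‖` carries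
-- minus its gradient as a subgradient of `r`.
theorem neg_smul_mem_frechetSubdiff {M : ℝ} {x z : E} (hM : 0 ≤ M) (htop : r z ≠ ⊤)
    (hbot : r z ≠ ⊥) (hzx : z ≠ x)
    (hmin : ∀ u, r z + ((M * ‖z - x‖ : ℝ) : EReal) ≤ r u + ((M * ‖u - x‖ : ℝ) : EReal)) :
    -(M / ‖z - x‖) • (z - x) ∈ frechetSubdiff r z := by
  refine mem_frechetSubdiff_of_quadratic_le (c := M / (2 * ‖z - x‖)) htop hbot fun u => ?_
  refine le_trans ?_ (add_coe_le_of_add_coe_le_add_coe (hmin u))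
  refine add_le_add_right (EReal.coe_le_coe_iff.2 ?_) _
  have hnorm := mul_le_mul_of_nonneg_left
    (norm_add_le_of_ne_zero (sub_ne_zero.2 hzx) (u - z)) hM
  rw [sub_add_sub_cancel'] at hnorm
  rw [real_inner_smul_left]
  calc -(M / ‖z - x‖) * inner ℝ (z - x) (u - z) - M / (2 * ‖z - x‖) * ‖u - z‖ ^ 2
      = M * ‖z - x‖ - M * (‖z - x‖ + inner ℝ (z - x) (u - z) / ‖z - x‖
        + ‖u - z‖ ^ 2 / (2 * ‖z - x‖)) := by ring
    _ ≤ M * ‖z - x‖ - M * ‖u - x‖ := by gcongr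

theorem exists_lipschitzWith_coe_eq {M : NNReal} (hbot : ∀ u, r u ≠ ⊥) (hfin : ∃ y, r y ≠ ⊤)
    (hmin : ∀ x, ∃ z, ∀ u, r z + ((M * ‖z - x‖ : ℝ) : EReal) ≤ r u + ((M * ‖u - x‖ : ℝ) : EReal))
    (hM : ∀ u, ∀ w ∈ frechetSubdiff r u, ‖w‖ < M) :
    ∃ ρ : E → ℝ, LipschitzWith M ρ ∧ ∀ u, r u = (ρ u : EReal) := by
  have hself : ∀ x, r x ≠ ⊤ ∧ ∀ u, r x ≤ r u + ((M * ‖u - x‖ : ℝ) : EReal) := fun x => by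
    obtain ⟨y, hy⟩ := hfin
    obtain ⟨z, hz⟩ := hmin x
    have hztop : r z ≠ ⊤ := fun htop => by
      have hzy := hz y
      rw [htop, EReal.top_add_coe, top_le_iff] at hzy
      exact EReal.add_ne_top hy (EReal.coe_ne_top _) hzy
    have hzx : z = x := by
      by_contra hne
      have hw := hM z _ (neg_smul_mem_frechetSubdiff M.2 hztop (hbot z) hne hz)
      rw [norm_smul, norm_neg, Real.norm_of_nonneg (div_nonneg M.2 (norm_nonneg _)),
        div_mul_cancel₀ _ (norm_ne_zero_iff.2 (sub_ne_zero.2 hne))] at hw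
      exact hw.false
    subst hzx
    exact ⟨hztop, fun u => by simpa using hz u⟩
  have hcoe : ∀ u, r u = ((r u).toReal : EReal) := fun u =>
    (EReal.coe_toReal (hself u).1 (hbot u)).symm
  refine ⟨fun u => (r u).toReal, LipschitzWith.of_le_add_mul M fun u v => ?_, hcoe⟩
  have hle := (hself u).2 v
  rwa [hcoe u, hcoe v, ← EReal.coe_add, EReal.coe_le_coe_iff, ← dist_eq_norm, dist_comm] at hle

theorem lipschitzWith_of_norm_gradient_le [CompleteSpace E] {f : E → ℝ} (hf : Differentiable ℝ f)
    {B : NNReal} (hB : ∀ u, ‖gradient f u‖ ≤ B) : LipschitzWith B f :=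
  lipschitzWith_of_nnnorm_fderiv_le hf fun u => by
    rw [← NNReal.coe_le_coe, coe_nnnorm]
    simpa only [gradient, LinearIsometryEquiv.norm_map] using hB u

theorem exists_lipschitzWith_coe_eq_of_norm_subdiff_le [ProperSpace E] {f : E → ℝ} {B B' : ℝ}
    (hf : Differentiable ℝ f) (hproper : IsProper fun u => (f u : EReal) + r u)
    (hlsc : LowerSemicontinuous fun u => (f u : EReal) + r u)
    (hcoer : IsCoercive fun u => (f u : EReal) + r u)
    (hB : ∀ u, ‖gradient f u‖ ≤ B) (hB' : ∀ u, ∀ v ∈ subdiff r u, ‖v‖ ≤ B') :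
    ∃ (M : NNReal) (ρ : E → ℝ), LipschitzWith M ρ ∧ ∀ u, r u = (ρ u : EReal) := by
  obtain ⟨hbot, y, hy⟩ := hproper
  have hlip : LipschitzWith B.toNNReal f :=
    lipschitzWith_of_norm_gradient_le hf fun u => (hB u).trans (Real.le_coe_toNNReal B)
  refine ⟨max B.toNNReal (B'.toNNReal + 1), exists_lipschitzWith_coe_eq
    (fun u hu => hbot u (by simp only [hu, EReal.add_bot]))
    ⟨y, fun hy' => hy (by simp only [hy', EReal.coe_add_top])⟩
    (exists_forall_add_norm_sub_le hlip (le_max_left _ _) hlsc hcoer) fun u w hw => ?_⟩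
  calc ‖w‖ ≤ B' := hB' u w (frechetSubdiff_subset_subdiff r u hw)
    _ ≤ B'.toNNReal := Real.le_coe_toNNReal B'
    _ < B'.toNNReal + 1 := lt_add_one _
    _ ≤ _ := by exact_mod_cast le_max_right _ _

end BoundedSubdifferential

section AveragedProximalGradient

variable {E : Type*} [NormedAddCommGroup E] [InnerProductSpace ℝ E]

/-- The averaged proximal gradient iteration
`x (k + 1) ∈ prox_{α k R} (T (x k) - α k ∇F (x k))` for a coercive objective `F + R` with both terms
Lipschitz and `F` smooth; `ξ (k + 1)` is the prox-subgradient of `R` at `x (k + 1)`. Prox-DGD is the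
case where `T` is multiplication by the mixing matrix. -/
structure IsAveragedProxGradient [CompleteSpace E] (T : E →ₗ[ℝ] E) (K : Submodule ℝ E)
    (F R : E → ℝ) (L : ℝ) (α : ℕ → ℝ) (x ξ : ℕ → E) : Prop where
  averaging : IsAveraging T K
  step : IsVanishingStep α
  smooth : IsLipschitzDifferentiable F L
  exists_norm_gradient_le : ∃ B : NNReal, ∀ u, ‖gradient F u‖ ≤ B
  exists_lipschitzWith : ∃ M : NNReal, LipschitzWith M R
  coercive : Tendsto (fun u => F u + R u) (Bornology.cobounded E) atTop
  mem_prox : ∀ k, x (k + 1) ∈ prox (α k) (fun u => (R u : EReal)) (T (x k) - α k • gradient F (x k))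
  add_smul_eq : ∀ k, x (k + 1) + α k • ξ (k + 1) = T (x k) - α k • gradient F (x k)

namespace IsLipschitzDifferentiable

variable [CompleteSpace E] {F : E → ℝ} {L : ℝ}

theorem hasGradientAt (hF : IsLipschitzDifferentiable F L) (u : E) :
    HasGradientAt F (gradient F u) u :=
  (hF.2.1 u).hasGradientAt

theorem continuous_gradient (hF : IsLipschitzDifferentiable F L) : Continuous (gradient F) :=
  (LipschitzWith.of_dist_le_mul (K := ⟨L, hF.1.le⟩) fun u v => by
    rw [dist_eq_norm, dist_eq_norm]
    exact hF.2.2 u v).continuous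

theorem le_quadratic (hF : IsLipschitzDifferentiable F L) (u v : E) :
    F v ≤ F u + inner ℝ (gradient F u) (v - u) + L / 2 * ‖v - u‖ ^ 2 :=
  le_quadratic_of_lipschitz_gradient hF.hasGradientAt hF.2.2 u v

theorem inner_gradient_le_of_convexOn (hF : IsLipschitzDifferentiable F L)
    (hconv : ConvexOn ℝ Set.univ F) (u v : E) : F u + inner ℝ (gradient F u) (v - u) ≤ F v :=
  (isProximalSubgradient_of_lipschitz_gradient hF.hasGradientAt hF.2.2 u).inner_le_of_convexOn
    hconv v

end IsLipschitzDifferentiable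

namespace IsAveragedProxGradient

variable [CompleteSpace E] {T : E →ₗ[ℝ] E} {K : Submodule ℝ E} {F R : E → ℝ} {L : ℝ} {α : ℕ → ℝ}
  {x ξ : ℕ → E}

theorem isProximalSubgradient (h : IsAveragedProxGradient T K F R L α x ξ) (k : ℕ) :
    IsProximalSubgradient R (1 / (2 * α k)) (x (k + 1)) (ξ (k + 1)) :=
  isProximalSubgradient_of_mem_prox (h.step.pos k) (h.mem_prox k) (h.add_smul_eq k)

theorem mem_subdiff (h : IsAveragedProxGradient T K F R L α x ξ) (k : ℕ) :
    ξ (k + 1) ∈ subdiff (fun u => (R u : EReal)) (x (k + 1)) :=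
  frechetSubdiff_subset_subdiff _ _ (h.isProximalSubgradient k).mem_frechetSubdiff

theorem exists_norm_subgradient_le (h : IsAveragedProxGradient T K F R L α x ξ) :
    ∃ M, ∀ k, ‖ξ (k + 1)‖ ≤ M := by
  obtain ⟨M, hM⟩ := h.exists_lipschitzWith
  exact ⟨M, fun k => (h.isProximalSubgradient k).norm_le_of_lipschitzWith hM⟩

theorem isPerturbedConsensus (h : IsAveragedProxGradient T K F R L α x ξ) :
    IsPerturbedConsensus T K α x fun k => gradient F (x k) + ξ (k + 1) where
  averaging := h.averaging
  step := h.step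
  succ_eq k := by
    rw [eq_sub_of_add_eq (h.add_smul_eq k), smul_add, sub_sub]
  bounded := by
    obtain ⟨B, hB⟩ := h.exists_norm_gradient_le
    obtain ⟨M, hM⟩ := h.exists_norm_subgradient_le
    exact ⟨B + M, fun k => (norm_add_le _ _).trans (add_le_add (hB _) (hM k))⟩

theorem succ_le (h : IsAveragedProxGradient T K F R L α x ξ) (k : ℕ) :
    F (x (k + 1)) + R (x (k + 1)) ≤ F (x k) + R (x k)
      + inner ℝ (gradient F (x k) + ξ (k + 1)) (x (k + 1) - x k)
      + (L + 1 / α k) / 2 * ‖x (k + 1) - x k‖ ^ 2 := by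
  have hF := h.smooth.le_quadratic (x k) (x (k + 1))
  have hR := (h.isProximalSubgradient k).le_inner_add (x k)
  rw [inner_add_left]
  linear_combination hF + hR

theorem succ_le_of_convexOn (h : IsAveragedProxGradient T K F R L α x ξ)
    (hR : ConvexOn ℝ Set.univ R) (k : ℕ) :
    F (x (k + 1)) + R (x (k + 1)) ≤ F (x k) + R (x k)
      + inner ℝ (gradient F (x k) + ξ (k + 1)) (x (k + 1) - x k)
      + (L + 0 / α k) / 2 * ‖x (k + 1) - x k‖ ^ 2 := by
  have hF := h.smooth.le_quadratic (x k) (x (k + 1))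
  have hR := (h.isProximalSubgradient k).inner_le_of_convexOn hR (x k)
  rw [← neg_sub (x (k + 1)), inner_neg_right] at hR
  rw [inner_add_left, zero_div, add_zero]
  linear_combination hF + hR

theorem continuous_objective (h : IsAveragedProxGradient T K F R L α x ξ) :
    Continuous fun u => F u + R u := by
  obtain ⟨M, hM⟩ := h.exists_lipschitzWith
  exact h.smooth.2.1.continuous.add hM.continuous

theorem exists_lipschitzWith_objective (h : IsAveragedProxGradient T K F R L α x ξ) :
    ∃ Λ : NNReal, LipschitzWith Λ fun u => F u + R u := by
  obtain ⟨B, hB⟩ := h.exists_norm_gradient_le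
  obtain ⟨M, hM⟩ := h.exists_lipschitzWith
  exact ⟨B + M, (lipschitzWith_of_norm_gradient_le h.smooth.2.1 hB).add hM⟩

end IsAveragedProxGradient

namespace IsAveragedProxGradient

variable [ProperSpace E] {T : E →ₗ[ℝ] E} {K : Submodule ℝ E} {F R : E → ℝ} {L : ℝ} {α : ℕ → ℝ}
  {x ξ : ℕ → E}

theorem exists_forall_le_objective (h : IsAveragedProxGradient T K F R L α x ξ) :
    ∃ b, ∀ u, b ≤ F u + R u := by
  have hcoer := h.coercive
  rw [Metric.cobounded_eq_cocompact] at hcoer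
  obtain ⟨u, hu⟩ := h.continuous_objective.exists_forall_le hcoer
  exact ⟨_, hu⟩

variable [K.HasOrthogonalProjection]

theorem exists_forall_mem_le_objective (h : IsAveragedProxGradient T K F R L α x ξ) :
    ∃ y ∈ K, ∀ z ∈ K, F y + R y ≤ F z + R z := by
  have hclosed : IsClosed (K : Set E) := by
    rw [← K.orthogonal_orthogonal]
    exact Kᗮ.isClosed_orthogonal
  have hfar := h.coercive.eventually_ge_atTop (F 0 + R 0)
  rw [Metric.cobounded_eq_cocompact] at hfar
  exact h.continuous_objective.continuousOn.exists_isMinOn' hclosed K.zero_mem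
    (hfar.filter_mono inf_le_left)

theorem tendsto_penalized_and_summable_of_convexOn (h : IsAveragedProxGradient T K F R L α x ξ)
    {μ : ℝ} (hμ : ∀ y, μ * ‖y‖ ^ 2 ≤ inner ℝ y (T y)) (hμ1 : -1 < μ)
    (hR : ConvexOn ℝ Set.univ R) :
    (∃ l, Tendsto (fun k => penalized T (fun u => F u + R u) (α k) (x k)) atTop (𝓝 l) ∧
      Tendsto (fun k => F (x k) + R (x k)) atTop (𝓝 l)) ∧
    Summable fun k => ((α k)⁻¹ * (1 + μ) - L) * ‖x (k + 1) - x k‖ ^ 2 := by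
  obtain ⟨b, hb⟩ := h.exists_forall_le_objective
  simpa only [sub_zero] using h.isPerturbedConsensus.tendsto_penalized_and_summable
    (S := fun u => F u + R u) (h.succ_le_of_convexOn hR) (fun k => hb (x k)) hμ (by linarith)

theorem tendsto_penalized_and_summable_of_pos (h : IsAveragedProxGradient T K F R L α x ξ)
    {μ : ℝ} (hμ : ∀ y, μ * ‖y‖ ^ 2 ≤ inner ℝ y (T y)) (hμ0 : 0 < μ) :
    (∃ l, Tendsto (fun k => penalized T (fun u => F u + R u) (α k) (x k)) atTop (𝓝 l) ∧
      Tendsto (fun k => F (x k) + R (x k)) atTop (𝓝 l)) ∧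
    Summable fun k => ((α k)⁻¹ * μ - L) * ‖x (k + 1) - x k‖ ^ 2 := by
  obtain ⟨b, hb⟩ := h.exists_forall_le_objective
  simpa only [add_sub_cancel_left] using h.isPerturbedConsensus.tendsto_penalized_and_summable
    (S := fun u => F u + R u) h.succ_le (fun k => hb (x k)) hμ (by linarith)

theorem tendsto_starProjection_zero (h : IsAveragedProxGradient T K F R L α x ξ)
    (hdiv : ¬ Summable α) {Lr : ℝ} (hLr : 0 ≤ Lr)
    (hξ : ∀ᶠ k in atTop, ‖ξ (k + 1) - ξ k‖ ≤ Lr * ‖x (k + 1) - x k‖) :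
    Tendsto (fun k => K.starProjection (gradient F (x k) + ξ (k + 1))) atTop (𝓝 0) := by
  obtain ⟨b, hb⟩ := h.exists_forall_le_objective
  have hL := h.smooth.1.le
  refine h.isPerturbedConsensus.tendsto_starProjection_zero
    (S := fun u => F u + R u) hdiv h.succ_le (fun k => hb (x k)) (add_nonneg hL hLr) ?_
  filter_upwards [(tendsto_add_atTop_nat 1).eventually hξ] with k hk
  rw [add_sub_add_comm]
  calc _ ≤ L * ‖x (k + 1) - x k‖ + Lr * ‖x (k + 2) - x (k + 1)‖ :=
        (norm_add_le _ _).trans (add_le_add (h.smooth.2.2 _ _) hk)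
    _ ≤ (L + Lr) * ‖x (k + 1) - x k‖ + (L + Lr) * ‖x (k + 2) - x (k + 1)‖ := by
      gcongr <;> linarith
    _ = _ := (mul_add _ _ _).symm

theorem tendsto_increment (h : IsAveragedProxGradient T K F R L α x ξ) :
    Tendsto (fun k => x (k + 1) - x k) atTop (𝓝 0) :=
  h.isPerturbedConsensus.increment_isBigO.trans_tendsto h.step.tendsto_zero

theorem tendsto_of_isolated_mapClusterPt (h : IsAveragedProxGradient T K F R L α x ξ) {y : E}
    (hy : MapClusterPt y atTop x) (hiso : ∃ U ∈ 𝓝 y, ∀ z ∈ U, MapClusterPt z atTop x → z = y) :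
    Tendsto x atTop (𝓝 y) :=
  ProxDGD.tendsto_of_isolated_mapClusterPt
    (by simpa only [dist_eq_norm, norm_zero] using h.tendsto_increment.norm) hy hiso

theorem mem_of_mapClusterPt (h : IsAveragedProxGradient T K F R L α x ξ) {y : E}
    (hy : MapClusterPt y atTop x) : y ∈ K := by
  obtain ⟨φ, hφ, hxφ⟩ := hy.tendsto_subseq
  have hdisagreement := h.isPerturbedConsensus.disagreement_isBigO.trans_tendsto
    h.step.tendsto_zero
  have horth := tendsto_nhds_unique ((Kᗮ.starProjection.continuous.tendsto y).comp hxφ)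
    (hdisagreement.comp hφ.tendsto_atTop)
  rwa [Kᗮ.starProjection_apply_eq_zero_iff, K.orthogonal_orthogonal] at horth

theorem exists_mem_subdiff_of_mapClusterPt (h : IsAveragedProxGradient T K F R L α x ξ)
    (hstat : Tendsto (fun k => K.starProjection (gradient F (x k) + ξ (k + 1))) atTop (𝓝 0))
    {y : E} (hy : MapClusterPt y atTop x) :
    ∃ ζ ∈ subdiff (fun u => (R u : EReal)) y, K.starProjection (gradient F y + ζ) = 0 := by
  obtain ⟨M, hM⟩ := h.exists_norm_subgradient_le
  obtain ⟨Λ, hΛ⟩ := h.exists_lipschitzWith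
  obtain ⟨ψ, hψ, hxψ⟩ := hy.tendsto_subseq
  obtain ⟨ζ, -, φ, hφ, hζ⟩ := tendsto_subseq_of_bounded
    (Metric.isBounded_closedBall (x := (0 : E)) (r := M))
    (x := fun j => ξ (ψ j + 1)) (fun j => by simpa using hM (ψ j))
  have hψφ : Tendsto (fun j => ψ (φ j)) atTop atTop := hψ.tendsto_atTop.comp hφ.tendsto_atTop
  have hx : Tendsto (fun j => x (ψ (φ j))) atTop (𝓝 y) := hxψ.comp hφ.tendsto_atTop
  have hx_succ : Tendsto (fun j => x (ψ (φ j) + 1)) atTop (𝓝 y) := by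
    simpa using (h.tendsto_increment.comp hψφ).add hx
  refine ⟨ζ, ⟨EReal.coe_ne_top _, EReal.coe_ne_bot _, _, _, hx_succ, ?_,
    fun j => (h.isProximalSubgradient (ψ (φ j))).mem_frechetSubdiff, hζ⟩, ?_⟩
  · exact ((continuous_coe_real_ereal.comp hΛ.continuous).tendsto y).comp hx_succ
  · have hv := (((h.smooth.continuous_gradient.tendsto y).comp hx).add hζ)
    exact tendsto_nhds_unique ((K.starProjection.continuous.tendsto _).comp hv) (hstat.comp hψφ)

theorem exists_add_inner_le (h : IsAveragedProxGradient T K F R L α x ξ)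
    (hF : ConvexOn ℝ Set.univ F) (hR : ConvexOn ℝ Set.univ R) :
    ∃ c, ∀ y k, F (x k) + R (x k) + inner ℝ (gradient F (x k) + ξ (k + 1)) (y - x k)
      ≤ F y + R y + c * α k := by
  obtain ⟨M, hM⟩ := h.exists_lipschitzWith
  obtain ⟨C, -, hC⟩ := h.step.exists_forall_norm_le_mul h.isPerturbedConsensus.increment_isBigO
  refine ⟨2 * M * C, fun y k => ?_⟩
  set d := x (k + 1) - x k with hd
  have hsmooth := h.smooth.inner_gradient_le_of_convexOn hF (x k) y
  have hprox := (h.isProximalSubgradient k).inner_le_of_convexOn hR y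
  rw [← sub_sub_sub_cancel_right y _ (x k), ← hd, inner_sub_right] at hprox
  have hdrift : M * ‖d‖ ≤ M * (C * α k) := by
    gcongr
    exact hC k
  have hlip := hM.le_add_mul (x k) (x (k + 1))
  rw [dist_comm, dist_eq_norm, ← hd] at hlip
  have hinner : inner ℝ (ξ (k + 1)) d ≤ M * ‖d‖ := (real_inner_le_norm _ _).trans <|
    mul_le_mul_of_nonneg_right ((h.isProximalSubgradient k).norm_le_of_lipschitzWith hM)
      (norm_nonneg d)
  rw [inner_add_left]
  linarith

theorem exists_sum_smul_sub_le (h : IsAveragedProxGradient T K F R L α x ξ)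
    (hF : ConvexOn ℝ Set.univ F) (hR : ConvexOn ℝ Set.univ R) {y : E} (hy : y ∈ K) :
    ∃ C, ∀ N, ∑ k ∈ Finset.range N, α k * (F (K.starProjection (x (k + 1)))
      + R (K.starProjection (x (k + 1))) - (F y + R y))
      ≤ C * (1 + ∑ k ∈ Finset.range N, α k ^ 2) := by
  obtain ⟨Λ, hΛ⟩ := h.exists_lipschitzWith_objective
  obtain ⟨c, hc⟩ := h.exists_add_inner_le hF hR
  exact h.isPerturbedConsensus.exists_sum_smul_sub_le hΛ hy (hc y)

end IsAveragedProxGradient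

end AveragedProximalGradient

section SymmetricAveraging

variable {E : Type*} [NormedAddCommGroup E] [InnerProductSpace ℝ E] {T : E →ₗ[ℝ] E}

theorem norm_map_sq_le_of_isSymmetric (hT : T.IsSymmetric)
    (hle : ∀ x, inner ℝ x (T x) ≤ ‖x‖ ^ 2) {μ : ℝ} (hμ : ∀ x, μ * ‖x‖ ^ 2 ≤ inner ℝ x (T x))
    (x : E) : ‖T x‖ ^ 2 ≤ ‖x‖ ^ 2 - (1 + μ) / 2 * ‖x - T x‖ ^ 2 := by
  have hlower := hμ (x - T x)
  have hupper := hle (x + T x)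
  have hsymm := hT x (T x)
  rw [norm_sub_sq_real] at hlower ⊢
  rw [norm_add_sq_real] at hupper
  simp only [map_sub, map_add, inner_sub_left, inner_sub_right, inner_add_left, inner_add_right,
    real_inner_self_eq_norm_sq] at hlower hupper hsymm
  linarith [real_inner_comm x (T x)]

theorem isAveraging_of_isSymmetric [FiniteDimensional ℝ E] {K : Submodule ℝ E}
    (hT : T.IsSymmetric) (hK : ∀ x, x ∈ K ↔ T x = x) (hle : ∀ x, inner ℝ x (T x) ≤ ‖x‖ ^ 2)
    {μ : ℝ} (hμ1 : -1 < μ) (hμ : ∀ x, μ * ‖x‖ ^ 2 ≤ inner ℝ x (T x)) : IsAveraging T K := by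
  have hker : LinearMap.ker ((LinearMap.id - T).domRestrict Kᗮ) = ⊥ := by
    refine LinearMap.ker_eq_bot'.2 fun x hx => Subtype.ext ?_
    have hfix : (x : E) ∈ K := (hK x).2 (sub_eq_zero.1 hx).symm
    exact Submodule.disjoint_def.1 K.orthogonal_disjoint _ hfix x.2
  obtain ⟨c, hc, hanti⟩ := ((LinearMap.id - T).domRestrict Kᗮ).exists_antilipschitzWith hker
  have : (0 : ℝ) < c := hc
  have hdisplacement : ∀ x ∈ Kᗮ, ‖x‖ ≤ c * ‖x - T x‖ := fun x hx => by
    simpa using hanti.le_mul_dist ⟨x, hx⟩ 0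
  have hgain : 0 < (1 + μ) / 2 / c ^ 2 := by
    have : 0 < 1 + μ := by linarith
    positivity
  refine ⟨hT, fun x hx => (hK x).1 hx, √(1 - (1 + μ) / 2 / c ^ 2), Real.sqrt_nonneg _,
    (Real.sqrt_lt' one_pos).2 (by linarith), fun x hx => ?_⟩
  rw [← Real.sqrt_sq (norm_nonneg x), ← Real.sqrt_mul' _ (sq_nonneg _)]
  refine Real.le_sqrt_of_sq_le ?_
  calc ‖T x‖ ^ 2 ≤ ‖x‖ ^ 2 - (1 + μ) / 2 * ‖x - T x‖ ^ 2 :=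
        norm_map_sq_le_of_isSymmetric hT hle hμ x
    _ = ‖x‖ ^ 2 - (1 + μ) / 2 / c ^ 2 * (c * ‖x - T x‖) ^ 2 := by field_simp
    _ ≤ ‖x‖ ^ 2 - (1 + μ) / 2 / c ^ 2 * ‖x‖ ^ 2 := by
      gcongr
      exact hdisplacement x hx
    _ = _ := by ring

end SymmetricAveraging

section Network

variable {n p : ℕ} {G : SimpleGraph (Fin n)} {W : Matrix (Fin n) (Fin n) ℝ}

/-- The consensus subspace: the stacks whose rows are all equal. -/
def consensus (n p : ℕ) : Submodule ℝ (Stack n p) where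
  carrier := {x | ∀ i j, x i = x j}
  zero_mem' _ _ := rfl
  add_mem' hx hy i j := congrArg₂ (· + ·) (hx i j) (hy i j)
  smul_mem' c _ hx i j := congrArg (c • ·) (hx i j)

theorem consensusSet_eq (hG : G.Connected) :
    consensusSet G = (consensus n p : Set (Stack n p)) := by
  ext x
  refine ⟨fun hx i j => ?_, fun hx i j _ => hx i j⟩
  obtain ⟨w⟩ := hG.preconnected i j
  induction w with
  | nil => rfl
  | cons hadj _ ih => exact (hx _ _ hadj).trans ih

theorem avg_eq_starProjection (x : Stack n p) : avg x = (consensus n p).starProjection x := by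
  have hmem : avg x ∈ consensus n p := fun _ _ => rfl
  refine (Submodule.eq_starProjection_of_mem_of_inner_eq_zero hmem fun w hw => ?_).symm
  rcases n.eq_zero_or_pos with rfl | hn
  · exact Finset.sum_empty
  have hmean : ∑ i, (x i - avg x i) = 0 := by
    have hn0 : (n : ℝ) ≠ 0 := by positivity
    simp only [avg, Finset.sum_sub_distrib, Finset.sum_const, Finset.card_univ, Fintype.card_fin,
      ← Nat.cast_smul_eq_nsmul ℝ, smul_inv_smul₀ hn0, sub_self]
  calc inner ℝ (x - avg x) w = ∑ i, inner ℝ (x i - avg x i) (w ⟨0, hn⟩) :=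
        Finset.sum_congr rfl fun i _ => by rw [hw ⟨0, hn⟩ i]; rfl
    _ = 0 := by rw [← sum_inner, hmean, inner_zero_left]

theorem sum_starProjection_consensus (x : Stack n p) :
    ∑ i, (consensus n p).starProjection x i = ∑ i, x i := by
  rcases n.eq_zero_or_pos with rfl | hn
  · rfl
  have hn0 : (n : ℝ) ≠ 0 := by positivity
  simp only [← avg_eq_starProjection, avg, Finset.sum_const, Finset.card_univ, Fintype.card_fin,
    ← Nat.cast_smul_eq_nsmul ℝ, smul_inv_smul₀ hn0]

/-- Multiplication of stacks by `W`, as a linear map. -/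
def mixLinear (W : Matrix (Fin n) (Fin n) ℝ) : Stack n p →ₗ[ℝ] Stack n p where
  toFun := mix W
  map_add' x y := by
    ext i : 1
    simp only [mix, PiLp.add_apply, smul_add, Finset.sum_add_distrib]
  map_smul' c x := by
    ext i : 1
    simp only [mix, PiLp.smul_apply, RingHom.id_apply, Finset.smul_sum, smul_comm c]

/-- The `c`-th column of a stack. Quadratic forms in `W` are evaluated column by column. -/
def column (x : Stack n p) (c : Fin p) : Fin n → ℝ := fun i => x i c

theorem column_mixLinear (x : Stack n p) (c : Fin p) :
    column (mixLinear W x) c = W.mulVec (column x c) := by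
  ext i
  simp [column, mixLinear, mix, Matrix.mulVec, dotProduct]

theorem inner_eq_sum_column (x y : Stack n p) :
    inner ℝ x y = ∑ c, column x c ⬝ᵥ column y c := by
  simp only [PiLp.inner_apply, column, dotProduct]
  rw [Finset.sum_comm]
  simp only [RCLike.inner_apply, conj_trivial, mul_comm]

theorem inner_mixLinear_le_of_posSemidef {A B : Matrix (Fin n) (Fin n) ℝ}
    (h : (B - A).PosSemidef) (x : Stack n p) :
    inner ℝ x (mixLinear A x) ≤ inner ℝ x (mixLinear B x) := by
  simp only [inner_eq_sum_column, column_mixLinear]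
  refine Finset.sum_le_sum fun c _ => ?_
  have hc := h.dotProduct_mulVec_nonneg (column x c)
  rwa [star_trivial, Matrix.sub_mulVec, dotProduct_sub, sub_nonneg] at hc

theorem mixLinear_smul_one (a : ℝ) (x : Stack n p) : mixLinear (a • 1) x = a • x := by
  ext i : 1
  simp [mixLinear, mix, Matrix.one_apply]

theorem isSymmetric_mixLinear (hW : W.IsSymm) :
    (mixLinear W : Stack n p →ₗ[ℝ] Stack n p).IsSymmetric := fun x y => by
  simp only [inner_eq_sum_column, column_mixLinear]
  refine Finset.sum_congr rfl fun c _ => ?_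
  rw [Matrix.dotProduct_mulVec, ← Matrix.mulVec_transpose, hW]

theorem posSemidef_sub_lamMin_smul_one (hW : W.IsHermitian) :
    (W - lamMin W • (1 : Matrix (Fin n) (Fin n) ℝ)).PosSemidef := by
  have hH : (W - lamMin W • (1 : Matrix (Fin n) (Fin n) ℝ)).IsHermitian :=
    hW.sub (Matrix.isHermitian_one.smul (IsSelfAdjoint.all _))
  rw [hH.posSemidef_iff_eigenvalues_nonneg]
  intro i
  have hmem : hH.eigenvalues i + lamMin W ∈ spectrum ℝ W := by
    have hadd := spectrum.add_mem_add_iff (R := ℝ) (a := W - lamMin W • 1)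
      (r := hH.eigenvalues i) (s := lamMin W)
    rw [Algebra.algebraMap_eq_smul_one, add_sub_cancel] at hadd
    exact hadd.2 (hH.eigenvalues_mem_spectrum_real i)
  refine le_of_add_le_add_right ((zero_add _).trans_le (csInf_le ?_ hmem))
  rw [hW.spectrum_real_eq_range_eigenvalues]
  exact (Set.finite_range _).bddBelow

theorem lamMin_mul_le_inner (hW : W.IsHermitian) (x : Stack n p) :
    lamMin W * ‖x‖ ^ 2 ≤ inner ℝ x (mixLinear W x) := by
  have hle := inner_mixLinear_le_of_posSemidef (posSemidef_sub_lamMin_smul_one hW) x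
  rwa [mixLinear_smul_one, real_inner_smul_right, real_inner_self_eq_norm_sq] at hle

namespace IsMixingMatrix

theorem isHermitian (hW : IsMixingMatrix G W) : W.IsHermitian :=
  (Matrix.conjTranspose_eq_transpose_of_trivial W).trans hW.symm

theorem neg_one_lt_lamMin [NeZero n] (hW : IsMixingMatrix G W) : -1 < lamMin W := by
  have hspec := hW.isHermitian.spectrum_real_eq_range_eigenvalues
  have hmem : lamMin W ∈ spectrum ℝ W := by
    rw [lamMin, hspec]
    exact (Set.range_nonempty _).csInf_mem (Set.finite_range _)
  have hshift : lamMin W + 1 ∈ spectrum ℝ (W + 1) := by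
    rw [add_comm W, ← map_one (algebraMap ℝ _), spectrum.add_mem_add_iff]
    exact hmem
  rw [hW.neg_one_lt.isHermitian.spectrum_real_eq_range_eigenvalues] at hshift
  obtain ⟨i, hi⟩ := hshift
  exact neg_lt_iff_pos_add.2 (hi ▸ hW.neg_one_lt.eigenvalues_pos i)

theorem inner_le (hW : IsMixingMatrix G W) (x : Stack n p) :
    inner ℝ x (mixLinear W x) ≤ ‖x‖ ^ 2 := by
  have hle := inner_mixLinear_le_of_posSemidef hW.le_one x
  rwa [← one_smul ℝ (1 : Matrix (Fin n) (Fin n) ℝ), mixLinear_smul_one, one_smul,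
    real_inner_self_eq_norm_sq] at hle

theorem mulVec_eq_self_iff (hW : IsMixingMatrix G W) (y : Fin n → ℝ) :
    W.mulVec y = y ↔ ∃ a : ℝ, ∀ i, y i = a := by
  have hmem : y ∈ LinearMap.ker (Matrix.toLin' (1 - W)) ↔ W.mulVec y = y := by
    rw [LinearMap.mem_ker, Matrix.toLin'_apply, Matrix.sub_mulVec, Matrix.one_mulVec, sub_eq_zero,
      eq_comm]
  rw [← hmem, hW.null_space, Submodule.mem_span_singleton]
  simp only [funext_iff, Pi.smul_apply, smul_eq_mul, mul_one, eq_comm]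

theorem mem_consensus_iff [NeZero n] (hW : IsMixingMatrix G W) (x : Stack n p) :
    x ∈ consensus n p ↔ mixLinear W x = x := by
  calc x ∈ consensus n p ↔ ∀ c, ∃ a : ℝ, ∀ i, column x c i = a :=
        ⟨fun hx c => ⟨x 0 c, fun i => by rw [column, hx i 0]⟩, fun hx i j => by
          ext c
          obtain ⟨a, ha⟩ := hx c
          exact (ha i).trans (ha j).symm⟩
    _ ↔ ∀ c, column (mixLinear W x) c = column x c := by
      simp only [column_mixLinear, hW.mulVec_eq_self_iff]
    _ ↔ mixLinear W x = x := by
      refine ⟨fun h => ?_, fun h c => by rw [h]⟩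
      ext i c
      exact congrFun (h c) i

theorem isAveraging [NeZero n] (hW : IsMixingMatrix G W) :
    IsAveraging (mixLinear W) (consensus n p) :=
  isAveraging_of_isSymmetric (isSymmetric_mixLinear hW.symm) hW.mem_consensus_iff hW.inner_le
    hW.neg_one_lt_lamMin (lamMin_mul_le_inner hW.isHermitian)

end IsMixingMatrix

end Network

section ErgodicRates

/-- The accuracy `(1 + ∑ α k ^ 2) / ∑ α k`, with sums over `k ≤ K`, which subgradient-type
estimates guarantee for the ergodic averages of the objective. -/
def ergodicRate (α : ℕ → ℝ) (K : ℕ) : ℝ :=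
  (1 + ∑ k ∈ Finset.range (K + 1), α k ^ 2) / ∑ k ∈ Finset.range (K + 1), α k

section ErgodicRate

variable {α : ℕ → ℝ}

theorem sum_range_succ_pos (hα : ∀ k, 0 < α k) (K : ℕ) :
    0 < ∑ k ∈ Finset.range (K + 1), α k :=
  Finset.sum_pos (fun k _ => hα k) Finset.nonempty_range_add_one

theorem centerMass_sub_isBigO_ergodicRate (hα : ∀ k, 0 < α k) {u : ℕ → ℝ} {s C : ℝ}
    (hs : ∀ k, s ≤ u k) (hu : ∀ N, ∑ k ∈ Finset.range N, α k * (u k - s)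
      ≤ C * (1 + ∑ k ∈ Finset.range N, α k ^ 2)) :
    (fun K => (Finset.range (K + 1)).centerMass α u - s) =O[atTop] ergodicRate α := by
  refine IsBigO.of_bound C (Eventually.of_forall fun K => ?_)
  have hA := sum_range_succ_pos hα K
  have hgap : (Finset.range (K + 1)).centerMass α u - s
      = (∑ k ∈ Finset.range (K + 1), α k * (u k - s)) / ∑ k ∈ Finset.range (K + 1), α k := by
    simp only [Finset.centerMass, smul_eq_mul, mul_sub, Finset.sum_sub_distrib, ← Finset.sum_mul]
    field_simp
  have hnonneg : 0 ≤ ∑ k ∈ Finset.range (K + 1), α k * (u k - s) :=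
    Finset.sum_nonneg fun k _ => mul_nonneg (hα k).le (sub_nonneg.2 (hs k))
  rw [hgap, ergodicRate, Real.norm_of_nonneg (by positivity), Real.norm_of_nonneg (by positivity),
    ← mul_div_assoc]
  gcongr
  exact hu _

theorem IsVanishingStep.tendsto_ergodicRate (hα : IsVanishingStep α) (hdiv : ¬ Summable α) :
    Tendsto (ergodicRate α) atTop (𝓝 0) := by
  have hsum : Tendsto (fun N => ∑ k ∈ Finset.range N, α k) atTop atTop :=
    (not_summable_iff_tendsto_nat_atTop_of_nonneg fun k => (hα.pos k).le).1 hdiv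
  have hsq : (fun k => α k ^ 2) =o[atTop] α := by
    simpa only [sq, one_mul] using
      ((isLittleO_one_iff ℝ).2 hα.tendsto_zero).mul_isBigO (isBigO_refl α atTop)
  have hone : (fun _ : ℕ => (1 : ℝ)) =o[atTop] fun N => ∑ k ∈ Finset.range N, α k :=
    (isLittleO_const_left.2 (Or.inr (tendsto_norm_atTop_atTop.comp hsum)))
  exact ((hone.add (hsq.sum_range (fun k => (hα.pos k).le) hsum)).tendsto_div_nhds_zero).comp
    (tendsto_add_atTop_nat 1)

theorem ergodicRate_isBigO {g h : ℕ → ℝ} (hg : ∀ᶠ K in atTop, 0 < g K)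
    (hsum : g =O[atTop] fun K => ∑ k ∈ Finset.range (K + 1), α k)
    (hone : (fun _ => (1 : ℝ)) =O[atTop] h)
    (hsq : (fun K => ∑ k ∈ Finset.range (K + 1), α k ^ 2) =O[atTop] h) :
    ergodicRate α =O[atTop] fun K => h K / g K := by
  simp only [div_eq_mul_inv]
  exact (hone.add hsq).mul (hsum.inv_rev (hg.mono fun K hK h0 => absurd h0 hK.ne'))

end ErgodicRate

section StepSize

variable {Lf ε : ℝ}

theorem stepSize_pos (hLf : 0 < Lf) (ε : ℝ) (k : ℕ) : 0 < stepSize Lf ε k := by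
  rw [stepSize]
  positivity

theorem stepSize_eq (Lf ε : ℝ) (k : ℕ) : stepSize Lf ε k = Lf⁻¹ * (((k : ℝ) + 1) ^ ε)⁻¹ := by
  rw [stepSize, one_div, mul_inv]

theorem stepSize_sq (Lf ε : ℝ) (k : ℕ) : stepSize Lf ε k ^ 2 = stepSize (Lf ^ 2) (2 * ε) k := by
  rw [stepSize, stepSize, div_pow, one_pow, mul_pow, mul_comm 2 ε, Real.rpow_mul (by positivity)]
  norm_cast

theorem isVanishingStep_stepSize (hLf : 0 < Lf) (hε : 0 < ε) :
    IsVanishingStep (stepSize Lf ε) where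
  pos := stepSize_pos hLf ε
  antitone k m hkm := by
    rw [stepSize, stepSize]
    gcongr
  tendsto_zero := by
    have hpow : Tendsto (fun k : ℕ => ((k : ℝ) + 1) ^ ε) atTop atTop :=
      (tendsto_rpow_atTop hε).comp (tendsto_natCast_atTop_atTop.atTop_add tendsto_const_nhds)
    have hlim := hpow.inv_tendsto_atTop.const_mul Lf⁻¹
    rw [mul_zero] at hlim
    exact hlim.congr fun k => (stepSize_eq Lf ε k).symm
  tendsto_ratio := by
    have hbase : Tendsto (fun k : ℕ => 1 + 1 / ((k : ℝ) + 1)) atTop (𝓝 1) := by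
      simpa using tendsto_one_div_add_atTop_nhds_zero_nat.const_add (1 : ℝ)
    have hpow := hbase.rpow_const (p := ε) (Or.inr hε.le)
    rw [Real.one_rpow] at hpow
    refine hpow.congr fun k => ?_
    have hratio : 1 + 1 / ((k : ℝ) + 1) = ((k : ℝ) + 1 + 1) / ((k : ℝ) + 1) := by field_simp
    rw [stepSize, stepSize, hratio, Real.div_rpow (by positivity) (by positivity)]
    push_cast
    field_simp

theorem not_summable_stepSize (hLf : 0 < Lf) (hε1 : ε ≤ 1) : ¬ Summable (stepSize Lf ε) := by
  intro h
  have hshift : Summable fun k : ℕ => ((((k + 1 : ℕ) : ℝ)) ^ ε)⁻¹ := by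
    refine (h.mul_left Lf).congr fun k => ?_
    rw [stepSize_eq, mul_inv_cancel_left₀ hLf.ne', Nat.cast_succ]
  rw [summable_nat_add_iff (f := fun k : ℕ => ((k : ℝ) ^ ε)⁻¹) 1,
    Real.summable_nat_rpow_inv] at hshift
  exact hshift.not_ge hε1

theorem rpow_isBigO_sum_stepSize (hLf : 0 < Lf) (hε : 0 ≤ ε) :
    (fun K : ℕ => (K : ℝ) ^ (1 - ε)) =O[atTop]
      fun K => ∑ k ∈ Finset.range (K + 1), stepSize Lf ε k := by
  refine IsBigO.of_bound (Lf * 2 ^ ε) ((eventually_ge_atTop 1).mono fun K hK => ?_)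
  have hK1 : (1 : ℝ) ≤ K := Nat.one_le_cast.2 hK
  have hK0 : (0 : ℝ) < K := by linarith
  have hterm : ∀ k ∈ Finset.range (K + 1), 1 / (Lf * (2 * (K : ℝ)) ^ ε) ≤ stepSize Lf ε k := by
    intro k hk
    have hkK : (k : ℝ) ≤ K := Nat.cast_le.2 (Nat.lt_succ_iff.1 (Finset.mem_range.1 hk))
    rw [stepSize]
    gcongr
    linarith
  have hsum := Finset.card_nsmul_le_sum _ _ _ hterm
  rw [Finset.card_range, nsmul_eq_mul] at hsum
  rw [Real.norm_of_nonneg (by positivity),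
    Real.norm_of_nonneg (sum_range_succ_pos (stepSize_pos hLf ε) K).le]
  calc (K : ℝ) ^ (1 - ε) = Lf * 2 ^ ε * (K * (1 / (Lf * (2 * (K : ℝ)) ^ ε))) := by
        rw [Real.rpow_sub hK0, Real.rpow_one, Real.mul_rpow zero_le_two hK0.le]
        field_simp
    _ ≤ Lf * 2 ^ ε * (((K + 1 : ℕ) : ℝ) * (1 / (Lf * (2 * (K : ℝ)) ^ ε))) := by
        gcongr
        exact K.le_succ
    _ ≤ Lf * 2 ^ ε * ∑ k ∈ Finset.range (K + 1), stepSize Lf ε k := by gcongr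

theorem mul_inv_rpow_le_rpow_sub_rpow {s : ℝ} (hs : 0 ≤ s) (hs1 : s ≤ 1) (m : ℕ) :
    (1 - s) * (((m : ℝ) + 1) ^ s)⁻¹ ≤ ((m : ℝ) + 1) ^ (1 - s) - (m : ℝ) ^ (1 - s) := by
  have hm : (0 : ℝ) < (m : ℝ) + 1 := by positivity
  have hinv : ((m : ℝ) + 1)⁻¹ ≤ 1 := inv_le_one_of_one_le₀ (by linarith [m.cast_nonneg (α := ℝ)])
  have hbernoulli : (m : ℝ) ^ (1 - s)
      ≤ ((m : ℝ) + 1) ^ (1 - s) * (1 + (1 - s) * -((m : ℝ) + 1)⁻¹) := by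
    calc (m : ℝ) ^ (1 - s) = (((m : ℝ) + 1) * (1 + -((m : ℝ) + 1)⁻¹)) ^ (1 - s) := by
          congr 1
          field_simp
          ring
      _ = ((m : ℝ) + 1) ^ (1 - s) * (1 + -((m : ℝ) + 1)⁻¹) ^ (1 - s) :=
          Real.mul_rpow hm.le (by linarith)
      _ ≤ _ := by
          gcongr
          exact rpow_one_add_le_one_add_mul_self (by linarith) (by linarith) (by linarith)
  have hpow : (((m : ℝ) + 1) ^ s)⁻¹ = ((m : ℝ) + 1) ^ (1 - s) * ((m : ℝ) + 1)⁻¹ := by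
    rw [Real.rpow_sub hm, Real.rpow_one]
    field_simp
  rw [hpow]
  linarith

theorem sum_stepSize_isBigO_rpow (hε : 0 ≤ ε) (hε1 : ε < 1) :
    (fun K => ∑ k ∈ Finset.range (K + 1), stepSize Lf ε k) =O[atTop]
      fun K : ℕ => (K : ℝ) ^ (1 - ε) := by
  have hs : 0 < 1 - ε := by linarith
  have hsum : ∀ N : ℕ, (1 - ε) * ∑ k ∈ Finset.range N, (((k : ℝ) + 1) ^ ε)⁻¹
      ≤ (N : ℝ) ^ (1 - ε) := by
    intro N
    have htel := Finset.sum_range_sub (fun k : ℕ => (k : ℝ) ^ (1 - ε)) N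
    rw [Nat.cast_zero, Real.zero_rpow hs.ne', sub_zero] at htel
    rw [Finset.mul_sum, ← htel]
    gcongr with k
    rw [Nat.cast_succ]
    exact mul_inv_rpow_le_rpow_sub_rpow hε hε1.le k
  simp only [stepSize_eq, ← Finset.mul_sum]
  refine IsBigO.const_mul_left (IsBigO.of_bound (2 ^ (1 - ε) / (1 - ε)) ?_) _
  filter_upwards [eventually_ge_atTop 1] with K hK
  have hK1 : (1 : ℝ) ≤ K := Nat.one_le_cast.2 hK
  rw [Real.norm_of_nonneg (Finset.sum_nonneg fun k _ => by positivity),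
    Real.norm_of_nonneg (by positivity), div_mul_eq_mul_div, le_div_iff₀' hs,
    ← Real.mul_rpow zero_le_two (by positivity)]
  refine (hsum (K + 1)).trans ?_
  gcongr
  push_cast
  linarith

theorem sum_stepSize_one (Lf : ℝ) (N : ℕ) :
    ∑ k ∈ Finset.range N, stepSize Lf 1 k = Lf⁻¹ * harmonic N := by
  simp only [stepSize_eq, Real.rpow_one, ← Finset.mul_sum, harmonic]
  push_cast
  rfl

theorem log_isBigO_sum_stepSize_one (hLf : 0 < Lf) :
    (fun K : ℕ => Real.log K) =O[atTop]
      fun K => ∑ k ∈ Finset.range (K + 1), stepSize Lf 1 k := by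
  refine IsBigO.of_bound Lf ((eventually_ge_atTop 1).mono fun K hK => ?_)
  have hK1 : (1 : ℝ) ≤ K := Nat.one_le_cast.2 hK
  rw [Real.norm_of_nonneg (Real.log_nonneg hK1),
    Real.norm_of_nonneg (sum_range_succ_pos (stepSize_pos hLf 1) K).le, sum_stepSize_one,
    mul_inv_cancel_left₀ hLf.ne']
  refine (Real.log_le_log (by linarith) ?_).trans (log_add_one_le_harmonic (K + 1))
  push_cast
  linarith

theorem one_isBigO_log : (fun _ : ℕ => (1 : ℝ)) =O[atTop] fun K : ℕ => Real.log K :=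
  (Real.isLittleO_const_log_atTop.comp_tendsto tendsto_natCast_atTop_atTop).isBigO

theorem sum_stepSize_one_isBigO_log :
    (fun K => ∑ k ∈ Finset.range (K + 1), stepSize Lf 1 k) =O[atTop]
      fun K : ℕ => Real.log K := by
  have hharmonic : (fun K : ℕ => (harmonic (K + 1) : ℝ)) =O[atTop]
      fun K : ℕ => 2 + Real.log K := by
    refine IsBigO.of_bound' ((eventually_ge_atTop 1).mono fun K hK => ?_)
    have hlog : 0 ≤ Real.log K := Real.log_nonneg (Nat.one_le_cast.2 hK)
    have hinv : ((K : ℝ) + 1)⁻¹ ≤ 1 :=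
      inv_le_one_of_one_le₀ (by linarith [K.cast_nonneg (α := ℝ)])
    have hle := harmonic_le_one_add_log K
    have hpos : (0 : ℝ) < harmonic (K + 1) := by exact_mod_cast harmonic_pos K.succ_ne_zero
    rw [Real.norm_of_nonneg hpos.le, Real.norm_of_nonneg (by linarith), harmonic_succ]
    push_cast
    linarith
  have htwo : (fun _ : ℕ => (2 : ℝ)) =O[atTop] fun K : ℕ => Real.log K :=
    (isBigO_const_const 2 one_ne_zero atTop).trans one_isBigO_log
  simp only [sum_stepSize_one]
  exact (hharmonic.trans (htwo.add (isBigO_refl _ _))).const_mul_left _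

theorem sum_stepSize_isBigO_one (hε : 1 < ε) :
    (fun K => ∑ k ∈ Finset.range (K + 1), stepSize Lf ε k) =O[atTop] fun _ => (1 : ℝ) := by
  have hsum : Summable (stepSize Lf ε) := by
    refine (((summable_nat_add_iff 1).2 (Real.summable_nat_rpow_inv.2 hε)).mul_left Lf⁻¹).congr
      fun k => ?_
    rw [stepSize_eq, Nat.cast_succ]
  exact (hsum.hasSum.tendsto_sum_nat.comp (tendsto_add_atTop_nat 1)).isBigO_one ℝ

theorem ergodicRate_stepSize_isBigO_inv_rpow (hLf : 0 < Lf) (hε : 0 ≤ ε) (hε2 : ε < 1 / 2) :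
    ergodicRate (stepSize Lf ε) =O[atTop] fun K : ℕ => 1 / (K : ℝ) ^ ε := by
  have hpos : ∀ᶠ K : ℕ in atTop, 0 < (K : ℝ) := tendsto_natCast_atTop_atTop.eventually_gt_atTop 0
  have hone : (fun _ : ℕ => (1 : ℝ)) =O[atTop] fun K : ℕ => (K : ℝ) ^ (1 - 2 * ε) :=
    (isBigO_const_left_iff_pos_le_norm one_ne_zero).2 ⟨1, one_pos, (eventually_ge_atTop 1).mono
      fun K hK => (Real.one_le_rpow (Nat.one_le_cast.2 hK) (by linarith)).trans (le_abs_self _)⟩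
  have hsq := sum_stepSize_isBigO_rpow (Lf := Lf ^ 2) (show 0 ≤ 2 * ε by linarith) (by linarith)
  simp only [← stepSize_sq] at hsq
  refine (ergodicRate_isBigO (hpos.mono fun K hK => Real.rpow_pos_of_pos hK _)
    (rpow_isBigO_sum_stepSize hLf hε) hone hsq).congr' EventuallyEq.rfl (hpos.mono fun K hK => ?_)
  simp only
  rw [← Real.rpow_sub hK, one_div, ← Real.rpow_neg hK.le]
  ring_nf

theorem ergodicRate_stepSize_half_isBigO (hLf : 0 < Lf) :
    ergodicRate (stepSize Lf (1 / 2)) =O[atTop] fun K : ℕ => Real.log K / Real.sqrt K := by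
  have hpos : ∀ᶠ K : ℕ in atTop, 0 < Real.sqrt K :=
    (tendsto_natCast_atTop_atTop.eventually_gt_atTop 0).mono fun K hK => Real.sqrt_pos.2 hK
  have hsum := rpow_isBigO_sum_stepSize hLf (show (0 : ℝ) ≤ 1 / 2 by norm_num)
  simp only [sub_half, ← Real.sqrt_eq_rpow] at hsum
  have hsq : (fun K => ∑ k ∈ Finset.range (K + 1), stepSize Lf (1 / 2) k ^ 2) =O[atTop]
      fun K : ℕ => Real.log K := by
    simpa only [stepSize_sq, mul_one_div_cancel (two_ne_zero (α := ℝ))]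
      using sum_stepSize_one_isBigO_log (Lf := Lf ^ 2)
  exact ergodicRate_isBigO hpos hsum one_isBigO_log hsq

theorem ergodicRate_stepSize_isBigO_inv_rpow_one_sub (hLf : 0 < Lf) (hε : 1 / 2 < ε) :
    ergodicRate (stepSize Lf ε) =O[atTop] fun K : ℕ => 1 / (K : ℝ) ^ (1 - ε) := by
  have hpos : ∀ᶠ K : ℕ in atTop, 0 < (K : ℝ) ^ (1 - ε) :=
    (tendsto_natCast_atTop_atTop.eventually_gt_atTop 0).mono fun K hK => Real.rpow_pos_of_pos hK _
  have hsq := sum_stepSize_isBigO_one (Lf := Lf ^ 2) (show 1 < 2 * ε by linarith)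
  simp only [← stepSize_sq] at hsq
  exact ergodicRate_isBigO hpos (rpow_isBigO_sum_stepSize hLf (by linarith)) (isBigO_refl _ _) hsq

theorem ergodicRate_stepSize_one_isBigO (hLf : 0 < Lf) :
    ergodicRate (stepSize Lf 1) =O[atTop] fun K : ℕ => 1 / Real.log K := by
  have hpos : ∀ᶠ K : ℕ in atTop, 0 < Real.log K :=
    (Real.tendsto_log_atTop.comp tendsto_natCast_atTop_atTop).eventually_gt_atTop 0
  have hsq := sum_stepSize_isBigO_one (Lf := Lf ^ 2) (show (1 : ℝ) < 2 * 1 by norm_num)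
  simp only [← stepSize_sq] at hsq
  exact ergodicRate_isBigO hpos (log_isBigO_sum_stepSize_one hLf) (isBigO_refl _ _) hsq

end StepSize

end ErgodicRates

section StackedObjective

variable {n p : ℕ} {f ρ : Fin n → Vec p → ℝ} {L : Fin n → ℝ}

theorem hasGradientAt_smoothSum (hf : ∀ i, Differentiable ℝ (f i)) (x : Stack n p) :
    HasGradientAt (smoothSum f) (gradStack f x) x := by
  have hterm : ∀ i ∈ Finset.univ, HasFDerivAt (fun x : Stack n p => f i (x i))
      ((InnerProductSpace.toDual ℝ (Vec p) (gradient (f i) (x i))).comp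
        (PiLp.proj 2 (fun _ => Vec p) i)) x := fun i _ =>
    HasFDerivAt.comp (f := fun x : Stack n p => x i) x (hf i (x i)).hasGradientAt.hasFDerivAt
      (PiLp.hasFDerivAt_apply 2 x i)
  refine (HasFDerivAt.fun_sum hterm).congr_fderiv (ContinuousLinearMap.ext fun v => ?_)
  simp [PiLp.inner_apply, gradStack]

theorem gradient_smoothSum (hf : ∀ i, Differentiable ℝ (f i)) :
    gradient (smoothSum f : Stack n p → ℝ) = gradStack f :=
  funext fun x => (hasGradientAt_smoothSum hf x).gradient

theorem le_maxConst (L : Fin n → ℝ) (i : Fin n) : L i ≤ maxConst L :=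
  le_ciSup (Set.finite_range L).bddAbove i

theorem isLipschitzDifferentiable_smoothSum [NeZero n]
    (hf : ∀ i, IsLipschitzDifferentiable (f i) (L i)) :
    IsLipschitzDifferentiable (smoothSum f) (maxConst L) := by
  have hL : 0 < maxConst L := (hf 0).1.trans_le (le_maxConst L 0)
  refine ⟨hL, fun x => (hasGradientAt_smoothSum (fun i => (hf i).2.1) x).differentiableAt,
    fun x y => ?_⟩
  rw [gradient_smoothSum fun i => (hf i).2.1]
  refine le_of_sq_le_sq ?_ (by positivity)
  rw [mul_pow, PiLp.norm_sq_eq_of_L2, PiLp.norm_sq_eq_of_L2, Finset.mul_sum]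
  refine Finset.sum_le_sum fun i _ => ?_
  rw [← mul_pow]
  exact pow_le_pow_left₀ (norm_nonneg _) (((hf i).2.2 _ _).trans
    (mul_le_mul_of_nonneg_right (le_maxConst L i) (norm_nonneg _))) 2

theorem exists_norm_gradStack_le (hB : ∀ i, ∃ B : ℝ, ∀ u, ‖gradient (f i) u‖ ≤ B) :
    ∃ B : NNReal, ∀ x : Stack n p, ‖gradStack f x‖ ≤ B := by
  choose B hB using hB
  refine ⟨NNReal.sqrt (∑ i, Real.toNNReal (B i) ^ 2), fun x => ?_⟩
  rw [Real.coe_sqrt]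
  refine Real.le_sqrt_of_sq_le ?_
  rw [PiLp.norm_sq_eq_of_L2]
  push_cast
  gcongr with i
  exact (hB i (x i)).trans (Real.le_coe_toNNReal _)

theorem exists_lipschitzWith_smoothSum (hρ : ∀ i, ∃ M : NNReal, LipschitzWith M (ρ i)) :
    ∃ M : NNReal, LipschitzWith M (smoothSum ρ : Stack n p → ℝ) := by
  choose M hM using hρ
  refine ⟨∑ i, M i, LipschitzWith.of_dist_le_mul fun x y => ?_⟩
  push_cast
  rw [Finset.sum_mul]
  refine (dist_sum_sum_le _ _ _).trans (Finset.sum_le_sum fun i _ => ?_)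
  refine ((hM i).dist_le_mul _ _).trans ?_
  gcongr
  rw [dist_eq_norm, dist_eq_norm]
  exact PiLp.norm_apply_le (x - y) i

theorem convexOn_smoothSum (hf : ∀ i, ConvexOn ℝ Set.univ (f i)) :
    ConvexOn ℝ Set.univ (smoothSum f : Stack n p → ℝ) := by
  refine ⟨convex_univ, fun x _ y _ a b ha hb hab => ?_⟩
  simp only [smoothSum, smul_eq_mul, Finset.mul_sum, ← Finset.sum_add_distrib]
  exact Finset.sum_le_sum fun i _ => (hf i).2 (Set.mem_univ (x i)) (Set.mem_univ (y i)) ha hb hab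

theorem tendsto_smoothSum_cobounded (hcont : ∀ i, Continuous (f i))
    (hcoer : ∀ i, Tendsto (f i) (Bornology.cobounded (Vec p)) atTop) :
    Tendsto (smoothSum f : Stack n p → ℝ) (Bornology.cobounded _) atTop := by
  have hmin : ∀ i, ∃ m, ∀ u, f i m ≤ f i u := fun i =>
    (hcont i).exists_forall_le (Metric.cobounded_eq_cocompact (α := Vec p) ▸ hcoer i)
  choose m hm using hmin
  have hpi : Tendsto (fun x : Fin n → Vec p => ∑ i, f i (x i)) (Bornology.cobounded _) atTop := by
    rw [Bornology.cobounded_pi, Filter.coprodᵢ, tendsto_iSup]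
    refine fun i => tendsto_atTop_mono (fun x => ?_) (tendsto_atTop_add_const_right _
      (∑ j ∈ Finset.univ.erase i, f j (m j)) ((hcoer i).comp tendsto_comap))
    rw [← Finset.add_sum_erase _ _ (Finset.mem_univ i)]
    gcongr with j
    · rfl
    · exact hm j (x j)
  exact hpi.comp (PiLp.antilipschitzWith_ofLp 2 _).tendsto_cobounded

theorem tendsto_cobounded_of_isCoercive {E : Type*} [NormedAddCommGroup E]
    [InnerProductSpace ℝ E] {h : E → ℝ} (hc : IsCoercive fun u => (h u : EReal)) :
    Tendsto h (Bornology.cobounded E) atTop := by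
  rw [← comap_norm_atTop]
  exact EReal.tendsto_coe_nhds_top_iff.1 hc

theorem coe_sum_toEReal {ι : Type*} (s : Finset ι) (g : ι → ℝ) :
    ((∑ i ∈ s, g i : ℝ) : EReal) = ∑ i ∈ s, (g i : EReal) :=
  map_sum (⟨⟨Real.toEReal, EReal.coe_zero⟩, EReal.coe_add⟩ : ℝ →+ EReal) g s

theorem rSum_coe (ρ : Fin n → Vec p → ℝ) :
    rSum (fun i u => (ρ i u : EReal)) = fun x => (smoothSum ρ x : EReal) :=
  funext fun _ => (coe_sum_toEReal _ _).symm

theorem objective_coe (f ρ : Fin n → Vec p → ℝ) (x : Stack n p) :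
    objective f (fun i u => (ρ i u : EReal)) x = ((smoothSum f x + smoothSum ρ x : ℝ) : EReal) := by
  simp only [objective, smoothSum, ← Finset.sum_add_distrib, coe_sum_toEReal, EReal.coe_add]

theorem lyapunov_coe (W : Matrix (Fin n) (Fin n) ℝ) (f ρ : Fin n → Vec p → ℝ) (a : ℝ)
    (x : Stack n p) : lyapunov W f (fun i u => (ρ i u : EReal)) a x
      = (penalized (mixLinear W) (fun u => smoothSum f u + smoothSum ρ u) a x : EReal) := by
  rw [lyapunov, rSum_coe, ← EReal.coe_add, penalized, seminormSq]
  congr 1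
  simp only [mixLinear, LinearMap.coe_mk, AddHom.coe_mk]
  ring

theorem ergodicObjective_coe (f ρ : Fin n → Vec p → ℝ) (α : ℕ → ℝ) (x : ℕ → Stack n p) (K : ℕ) :
    ergodicObjective f (fun i u => (ρ i u : EReal)) α x K
      = ((Finset.range (K + 1)).centerMass α fun k =>
          smoothSum f ((consensus n p).starProjection (x (k + 1)))
            + smoothSum ρ ((consensus n p).starProjection (x (k + 1))) : ℝ) := by
  simp only [ergodicObjective, objective_coe, ← EReal.coe_mul, ← coe_sum_toEReal, ← EReal.coe_div,
    avg_eq_starProjection, Finset.centerMass, smul_eq_mul, inv_mul_eq_div]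

end StackedObjective

section FiniteProxDGD

variable {n p : ℕ} {G : SimpleGraph (Fin n)} {W : Matrix (Fin n) (Fin n) ℝ}
  {f ρ : Fin n → Vec p → ℝ} {Lf : ℝ} {α : ℕ → ℝ} {x ξ : ℕ → Stack n p}

/-- Prox-DGD for finite Lipschitz functions `r_i = ρ i`, viewed as an averaged proximal gradient
iteration on the stacked copies: `W` plays the role of the averaging operator, and the consensus
subspace is its fixed space. -/
def IsFiniteProxDGD (W : Matrix (Fin n) (Fin n) ℝ) (f ρ : Fin n → Vec p → ℝ) (Lf : ℝ) (α : ℕ → ℝ)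
    (x ξ : ℕ → Stack n p) : Prop :=
  IsAveragedProxGradient (mixLinear W) (consensus n p) (smoothSum f) (smoothSum ρ) Lf α x ξ

theorem isFiniteProxDGD_of_isProxDGD [NeZero n] {L : Fin n → ℝ} (hW : IsMixingMatrix G W)
    (hf : ∀ i, IsLipschitzDifferentiable (f i) (L i))
    (hBf : ∀ i, ∃ B : ℝ, ∀ u, ‖gradient (f i) u‖ ≤ B)
    (hρ : ∀ i, ∃ M : NNReal, LipschitzWith M (ρ i))
    (hcoer : ∀ i, IsCoercive fun u => (f i u : EReal) + ρ i u) (hα : IsVanishingStep α)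
    (hx : IsProxDGD W f (fun i u => (ρ i u : EReal)) α x) (hξ : IsProxSubgradSeq W f α x ξ) :
    IsFiniteProxDGD W f ρ (maxConst L) α x ξ where
  averaging := hW.isAveraging
  step := hα
  smooth := isLipschitzDifferentiable_smoothSum hf
  exists_norm_gradient_le := by
    rw [gradient_smoothSum fun i => (hf i).2.1]
    exact exists_norm_gradStack_le hBf
  exists_lipschitzWith := exists_lipschitzWith_smoothSum hρ
  coercive := by
    have hcont : ∀ i, Continuous fun u => f i u + ρ i u := fun i =>
      (hf i).2.1.continuous.add (hρ i).choose_spec.continuous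
    exact (tendsto_smoothSum_cobounded hcont fun i =>
      tendsto_cobounded_of_isCoercive (hcoer i)).congr fun _ => Finset.sum_add_distrib
  mem_prox k := by
    rw [← rSum_coe, gradient_smoothSum fun i => (hf i).2.1]
    exact hx k
  add_smul_eq k := by
    rw [gradient_smoothSum fun i => (hf i).2.1]
    exact hξ k

theorem exists_eq_coe_and_isFiniteProxDGD [NeZero n] {r : Fin n → Vec p → EReal} {L : Fin n → ℝ}
    (hW : IsMixingMatrix G W) (hf : ∀ i, IsLipschitzDifferentiable (f i) (L i))
    (hproper : ∀ i, IsProper fun u => (f i u : EReal) + r i u)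
    (hlsc : ∀ i, LowerSemicontinuous fun u => (f i u : EReal) + r i u)
    (hcoer : ∀ i, IsCoercive fun u => (f i u : EReal) + r i u)
    (hBf : ∀ i, ∃ B : ℝ, ∀ u, ‖gradient (f i) u‖ ≤ B)
    (hBr : ∀ i, ∃ B : ℝ, ∀ u, ∀ v ∈ subdiff (r i) u, ‖v‖ ≤ B) (hα : IsVanishingStep α)
    (hx : IsProxDGD W f r α x) (hξ : IsProxSubgradSeq W f α x ξ) :
    ∃ ρ : Fin n → Vec p → ℝ, (r = fun i u => (ρ i u : EReal)) ∧
      IsFiniteProxDGD W f ρ (maxConst L) α x ξ := by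
  have hfinite : ∀ i, ∃ (M : NNReal) (ρ : Vec p → ℝ),
      LipschitzWith M ρ ∧ ∀ u, r i u = (ρ u : EReal) := fun i =>
    have ⟨_, hB⟩ := hBf i
    have ⟨_, hB'⟩ := hBr i
    exists_lipschitzWith_coe_eq_of_norm_subdiff_le (hf i).2.1 (hproper i) (hlsc i) (hcoer i) hB hB'
  choose M ρ hM hrρ using hfinite
  obtain rfl : r = fun i u => (ρ i u : EReal) := funext₂ hrρ
  exact ⟨ρ, rfl, isFiniteProxDGD_of_isProxDGD hW hf hBf (fun i => ⟨M i, hM i⟩) hcoer hα hx hξ⟩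

namespace IsFiniteProxDGD

theorem exists_tendsto_lyapunov_objective [NeZero n] (h : IsFiniteProxDGD W f ρ Lf α x ξ)
    (hW : IsMixingMatrix G W)
    (hcase : (∀ i, IsConvexFun fun u => (ρ i u : EReal)) ∨ 0 < lamMin W) :
    ∃ l : ℝ, Tendsto (fun k => lyapunov W f (fun i u => (ρ i u : EReal)) (α k) (x k)) atTop
        (𝓝 (l : EReal)) ∧
      Tendsto (fun k => objective f (fun i u => (ρ i u : EReal)) (x k)) atTop
        (𝓝 (l : EReal)) := by
  simp only [lyapunov_coe, objective_coe, EReal.tendsto_coe]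
  have hlam := lamMin_mul_le_inner (p := p) hW.isHermitian
  rcases hcase with hconv | hpos
  · exact (h.tendsto_penalized_and_summable_of_convexOn hlam hW.neg_one_lt_lamMin
      (convexOn_smoothSum fun i => convexOn_of_isConvexFun (hconv i))).1
  · exact (h.tendsto_penalized_and_summable_of_pos hlam hpos).1

theorem summable_of_isConvexFun [NeZero n] (h : IsFiniteProxDGD W f ρ Lf α x ξ)
    (hW : IsMixingMatrix G W) (hconv : ∀ i, IsConvexFun fun u => (ρ i u : EReal)) :
    Summable fun k => ((α k)⁻¹ * (1 + lamMin W) - Lf) * ‖x (k + 1) - x k‖ ^ 2 :=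
  (h.tendsto_penalized_and_summable_of_convexOn (lamMin_mul_le_inner hW.isHermitian)
    hW.neg_one_lt_lamMin (convexOn_smoothSum fun i => convexOn_of_isConvexFun (hconv i))).2

theorem summable_of_lamMin_pos (h : IsFiniteProxDGD W f ρ Lf α x ξ)
    (hW : IsMixingMatrix G W) (hpos : 0 < lamMin W) :
    Summable fun k => ((α k)⁻¹ * lamMin W - Lf) * ‖x (k + 1) - x k‖ ^ 2 :=
  (h.tendsto_penalized_and_summable_of_pos (lamMin_mul_le_inner hW.isHermitian) hpos).2

theorem mem_subdiff_rSum (h : IsFiniteProxDGD W f ρ Lf α x ξ) (k : ℕ) :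
    ξ (k + 1) ∈ subdiff (rSum fun i u => (ρ i u : EReal)) (x (k + 1)) := by
  rw [rSum_coe]
  exact h.mem_subdiff k

theorem tendsto_starProjection_gradStack_add (h : IsFiniteProxDGD W f ρ Lf α x ξ)
    (hf : ∀ i, Differentiable ℝ (f i)) (hdiv : ¬ Summable α) {Lr : ℝ} (hLr : 0 ≤ Lr)
    (hξ : ∀ᶠ k in atTop, ‖ξ (k + 1) - ξ k‖ ≤ Lr * ‖x (k + 1) - x k‖) :
    Tendsto (fun k => (consensus n p).starProjection (gradStack f (x k) + ξ (k + 1))) atTop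
      (𝓝 0) := by
  rw [← gradient_smoothSum hf]
  exact h.tendsto_starProjection_zero hdiv hLr hξ

theorem isStationary_of_mapClusterPt (h : IsFiniteProxDGD W f ρ Lf α x ξ) (hG : G.Connected)
    (hf : ∀ i, Differentiable ℝ (f i))
    (hstat : Tendsto (fun k => (consensus n p).starProjection (gradStack f (x k) + ξ (k + 1)))
      atTop (𝓝 0)) {y : Stack n p} (hy : MapClusterPt y atTop x) :
    IsStationary G f (fun i u => (ρ i u : EReal)) y := by
  rw [← gradient_smoothSum hf] at hstat
  obtain ⟨ζ, hζ, hproj⟩ := h.exists_mem_subdiff_of_mapClusterPt hstat hy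
  rw [gradient_smoothSum hf] at hproj
  refine ⟨consensusSet_eq hG ▸ h.mem_of_mapClusterPt hy, ζ, rSum_coe ρ ▸ hζ, ?_⟩
  have hsum := sum_starProjection_consensus (gradStack f y + ζ)
  rw [hproj] at hsum
  simpa using hsum.symm

theorem exists_isLeast_and_isBigO_ergodicRate (h : IsFiniteProxDGD W f ρ Lf α x ξ)
    (hG : G.Connected) (hf : ∀ i, ConvexOn ℝ Set.univ (f i))
    (hρ : ∀ i, IsConvexFun fun u => (ρ i u : EReal)) :
    ∃ (sopt : ℝ) (sbar : ℕ → ℝ),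
      IsLeast (objective f (fun i u => (ρ i u : EReal)) '' consensusSet G) (sopt : EReal) ∧
      (∀ K, ergodicObjective f (fun i u => (ρ i u : EReal)) α x K = (sbar K : EReal)) ∧
      (fun K => sbar K - sopt) =O[atTop] ergodicRate α := by
  obtain ⟨y, hy, hmin⟩ := h.exists_forall_mem_le_objective
  obtain ⟨C, hC⟩ := h.exists_sum_smul_sub_le (convexOn_smoothSum hf)
    (convexOn_smoothSum fun i => convexOn_of_isConvexFun (hρ i)) hy
  refine ⟨smoothSum f y + smoothSum ρ y, _, ⟨⟨y, ?_, objective_coe f ρ y⟩, ?_⟩,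
    ergodicObjective_coe f ρ α x,
    centerMass_sub_isBigO_ergodicRate h.step.pos (fun k => hmin _ (Submodule.coe_mem _)) hC⟩
  · rwa [consensusSet_eq hG]
  · rintro _ ⟨z, hz, rfl⟩
    rw [consensusSet_eq hG] at hz
    rw [objective_coe, EReal.coe_le_coe_iff]
    exact hmin z hz

end IsFiniteProxDGD

theorem tendsto_sum_of_tendsto_starProjection {v : ℕ → Stack n p}
    (hv : Tendsto (fun k => (consensus n p).starProjection (v k)) atTop (𝓝 0)) :
    Tendsto (fun k => ∑ i, v k i) atTop (𝓝 0) := by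
  have hcont : Continuous fun w : Stack n p => ∑ i, w i :=
    continuous_finsetSum _ fun i _ => by fun_prop
  simpa [Function.comp_def, sum_starProjection_consensus] using (hcont.tendsto 0).comp hv

end FiniteProxDGD

end ProxDGD

end

theorem theorem4_general {n p : ℕ}
    (G : SimpleGraph (Fin n)) (hG : G.Connected)
    (W : Matrix (Fin n) (Fin n) ℝ) (hW : ProxDGD.IsMixingMatrix G W)
    (f : Fin n → ProxDGD.Vec p → ℝ) (r : Fin n → ProxDGD.Vec p → EReal) (L : Fin n → ℝ)
    (hf : ∀ i, ProxDGD.IsLipschitzDifferentiable (f i) (L i))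
    (hproper : ∀ i, ProxDGD.IsProper (fun u => (f i u : EReal) + r i u))
    (hlsc : ∀ i, LowerSemicontinuous (fun u => (f i u : EReal) + r i u))
    (hcoer : ∀ i, ProxDGD.IsCoercive (fun u => (f i u : EReal) + r i u))
    (hBf : ∀ i, ∃ B : ℝ, ∀ u, ‖gradient (f i) u‖ ≤ B)
    (hBr : ∀ i, ∃ B : ℝ, ∀ u, ∀ v ∈ ProxDGD.subdiff (r i) u, ‖v‖ ≤ B)
    (Lf : ℝ) (hLf : Lf = ProxDGD.maxConst L)
    (ε : ℝ) (hε : 0 < ε)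
    (α : ℕ → ℝ) (hα : α = ProxDGD.stepSize Lf ε)
    (x ξ : ℕ → ProxDGD.Stack n p) (hx : ProxDGD.IsProxDGD W f r α x)
    (hξ : ProxDGD.IsProxSubgradSeq W f α x ξ) :
    (((∀ i, ProxDGD.IsConvexFun (r i)) ∨ 0 < ProxDGD.lamMin W) →
      ∃ l : ℝ,
        Tendsto (fun k => ProxDGD.lyapunov W f r (α k) (x k)) atTop (𝓝 (l : EReal)) ∧
        Tendsto (fun k => ProxDGD.objective f r (x k)) atTop (𝓝 (l : EReal))) ∧
    ((∀ i, ProxDGD.IsConvexFun (r i)) →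
      Summable (fun k =>
        ((α k)⁻¹ * (1 + ProxDGD.lamMin W) - Lf) * ‖x (k + 1) - x k‖ ^ 2)) ∧
    (0 < ProxDGD.lamMin W →
      Summable (fun k =>
        ((α k)⁻¹ * ProxDGD.lamMin W - Lf) * ‖x (k + 1) - x k‖ ^ 2)) ∧
    (∀ k, ξ (k + 1) ∈ ProxDGD.subdiff (ProxDGD.rSum r) (x (k + 1))) ∧
    (ε ≤ 1 → (∃ Lr : ℝ, 0 < Lr ∧ ∃ k₀ : ℕ, 0 < k₀ ∧
        ∀ k, k₀ < k → ‖ξ (k + 1) - ξ k‖ ≤ Lr * ‖x (k + 1) - x k‖) →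
      Tendsto (fun k => ∑ i, (ProxDGD.gradStack f (x k) i + ξ (k + 1) i)) atTop (𝓝 0) ∧
      ∀ y, MapClusterPt y atTop x → ProxDGD.IsStationary G f r y) ∧
    (∀ y, MapClusterPt y atTop x →
      (∃ U ∈ 𝓝 y, ∀ z ∈ U, MapClusterPt z atTop x → z = y) →
      Tendsto x atTop (𝓝 y)) ∧
    ((∀ i, ConvexOn ℝ Set.univ (f i)) → (∀ i, ProxDGD.IsConvexFun (r i)) →
      ∃ (sopt : ℝ) (sbar : ℕ → ℝ),
        IsLeast (ProxDGD.objective f r '' ProxDGD.consensusSet G) (sopt : EReal) ∧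
        (∀ K, ProxDGD.ergodicObjective f r α x K = (sbar K : EReal)) ∧
        (ε ≤ 1 → Tendsto sbar atTop (𝓝 sopt)) ∧
        (ε < 1 / 2 →
          (fun K => sbar K - sopt) =O[atTop] fun K : ℕ => 1 / (K : ℝ) ^ ε) ∧
        (ε = 1 / 2 →
          (fun K => sbar K - sopt) =O[atTop] fun K : ℕ => Real.log K / Real.sqrt K) ∧
        (1 / 2 < ε → ε < 1 →
          (fun K => sbar K - sopt) =O[atTop] fun K : ℕ => 1 / (K : ℝ) ^ (1 - ε)) ∧
        (ε = 1 →
          (fun K => sbar K - sopt) =O[atTop] fun K : ℕ => 1 / Real.log K)) := by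
  obtain ⟨i₀⟩ := hG.nonempty
  have : NeZero n := ⟨i₀.pos.ne'⟩
  have hdiff : ∀ i, Differentiable ℝ (f i) := fun i => (hf i).2.1
  subst hLf hα
  have hL : 0 < ProxDGD.maxConst L := (hf i₀).1.trans_le (ProxDGD.le_maxConst L i₀)
  have hstep := ProxDGD.isVanishingStep_stepSize hL hε
  obtain ⟨ρ, rfl, h⟩ := ProxDGD.exists_eq_coe_and_isFiniteProxDGD hW hf hproper hlsc hcoer hBf hBr
    hstep hx hξ
  refine ⟨h.exists_tendsto_lyapunov_objective hW, h.summable_of_isConvexFun hW,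
    h.summable_of_lamMin_pos hW, h.mem_subdiff_rSum, ?_,
    fun y => h.tendsto_of_isolated_mapClusterPt, fun hfc hrc => ?_⟩
  · rintro hε1 ⟨Lr, hLr, k₀, -, hk₀⟩
    have hstat := h.tendsto_starProjection_gradStack_add hdiff
      (ProxDGD.not_summable_stepSize hL hε1) hLr.le ((eventually_gt_atTop k₀).mono hk₀)
    exact ⟨by simpa only [PiLp.add_apply] using ProxDGD.tendsto_sum_of_tendsto_starProjection hstat,
      fun y => h.isStationary_of_mapClusterPt hG hdiff hstat⟩
  · obtain ⟨sopt, sbar, hopt, hsbar, hO⟩ := h.exists_isLeast_and_isBigO_ergodicRate hG hfc hrc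
    have hlim (hε1 : ε ≤ 1) : Tendsto sbar atTop (𝓝 sopt) := tendsto_sub_nhds_zero_iff.1
      (hO.trans_tendsto (hstep.tendsto_ergodicRate (ProxDGD.not_summable_stepSize hL hε1)))
    exact ⟨sopt, sbar, hopt, hsbar, hlim,
      fun hlt => hO.trans (ProxDGD.ergodicRate_stepSize_isBigO_inv_rpow hL hε.le hlt),
      fun heq => hO.trans (by subst heq; exact ProxDGD.ergodicRate_stepSize_half_isBigO hL),
      fun hlt _ => hO.trans (ProxDGD.ergodicRate_stepSize_isBigO_inv_rpow_one_sub hL hlt),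
      fun heq => hO.trans (by subst heq; exact ProxDGD.ergodicRate_stepSize_one_isBigO hL)⟩

theorem theorem4 {n p : ℕ}
    -- the connected network and the mixing matrix
    (G : SimpleGraph (Fin n)) (hG : G.Connected)
    (W : Matrix (Fin n) (Fin n) ℝ) (hW : ProxDGD.IsMixingMatrix G W)
    -- the composite objective
    (f : Fin n → ProxDGD.Vec p → ℝ) (r : Fin n → ProxDGD.Vec p → EReal) (L : Fin n → ℝ)
    (hf : ∀ i, ProxDGD.IsLipschitzDifferentiable (f i) (L i))
    (hproper : ∀ i, ProxDGD.IsProper (fun u => (f i u : EReal) + r i u))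
    (hlsc : ∀ i, LowerSemicontinuous (fun u => (f i u : EReal) + r i u))
    (hcoer : ∀ i, ProxDGD.IsCoercive (fun u => (f i u : EReal) + r i u))
    -- bounded gradients and subgradients
    (hBf : ∀ i, ∃ B : ℝ, ∀ u, ‖gradient (f i) u‖ ≤ B)
    (hBr : ∀ i, ∃ B : ℝ, ∀ u, ∀ v ∈ ProxDGD.subdiff (r i) u, ‖v‖ ≤ B)
    -- the step sizes
    (Lf : ℝ) (hLf : Lf = ProxDGD.maxConst L)
    (ε : ℝ) (hε : 0 < ε) (hε1 : ε ≤ 1)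
    (α : ℕ → ℝ) (hα : α = ProxDGD.stepSize Lf ε)
    -- the iterates and the prox-subgradients
    (x ξ : ℕ → ProxDGD.Stack n p) (hx : ProxDGD.IsProxDGD W f r α x)
    (hξ : ProxDGD.IsProxSubgradSeq W f α x ξ) :
    -- (a)
    (((∀ i, ProxDGD.IsConvexFun (r i)) ∨ 0 < ProxDGD.lamMin W) →
      ∃ l : ℝ,
        Tendsto (fun k => ProxDGD.lyapunov W f r (α k) (x k)) atTop (𝓝 (l : EReal)) ∧
        Tendsto (fun k => ProxDGD.objective f r (x k)) atTop (𝓝 (l : EReal))) ∧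
    -- (b)
    ((∀ i, ProxDGD.IsConvexFun (r i)) →
      Summable (fun k =>
        ((α k)⁻¹ * (1 + ProxDGD.lamMin W) - Lf) * ‖x (k + 1) - x k‖ ^ 2)) ∧
    (0 < ProxDGD.lamMin W →
      Summable (fun k =>
        ((α k)⁻¹ * ProxDGD.lamMin W - Lf) * ‖x (k + 1) - x k‖ ^ 2)) ∧
    -- (c)
    (∀ k, ξ (k + 1) ∈ ProxDGD.subdiff (ProxDGD.rSum r) (x (k + 1))) ∧
    ((∃ Lr : ℝ, 0 < Lr ∧ ∃ k₀ : ℕ, 0 < k₀ ∧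
        ∀ k, k₀ < k → ‖ξ (k + 1) - ξ k‖ ≤ Lr * ‖x (k + 1) - x k‖) →
      Tendsto (fun k => ∑ i, (ProxDGD.gradStack f (x k) i + ξ (k + 1) i)) atTop (𝓝 0) ∧
      ∀ y, MapClusterPt y atTop x → ProxDGD.IsStationary G f r y) ∧
    -- (d)
    (∀ y, MapClusterPt y atTop x →
      (∃ U ∈ 𝓝 y, ∀ z ∈ U, MapClusterPt z atTop x → z = y) →
      Tendsto x atTop (𝓝 y)) ∧
    -- (e)
    ((∀ i, ConvexOn ℝ Set.univ (f i)) → (∀ i, ProxDGD.IsConvexFun (r i)) →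
      0 < ProxDGD.lamMin W →
      ∃ (sopt : ℝ) (sbar : ℕ → ℝ),
        IsLeast (ProxDGD.objective f r '' ProxDGD.consensusSet G) (sopt : EReal) ∧
        (∀ K, ProxDGD.ergodicObjective f r α x K = (sbar K : EReal)) ∧
        Tendsto sbar atTop (𝓝 sopt) ∧
        (ε < 1 / 2 →
          (fun K => sbar K - sopt) =O[atTop] fun K : ℕ => 1 / (K : ℝ) ^ ε) ∧
        (ε = 1 / 2 →
          (fun K => sbar K - sopt) =O[atTop] fun K : ℕ => Real.log K / Real.sqrt K) ∧
        (1 / 2 < ε → ε < 1 →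
          (fun K => sbar K - sopt) =O[atTop] fun K : ℕ => 1 / (K : ℝ) ^ (1 - ε)) ∧
        (ε = 1 →
          (fun K => sbar K - sopt) =O[atTop] fun K : ℕ => 1 / Real.log K)) := by
  obtain ⟨ha, hb, hb', hc, hc', hd, he⟩ := theorem4_general G hG W hW f r L hf hproper hlsc hcoer
    hBf hBr Lf hLf ε hε α hα x ξ hx hξ
  exact ⟨ha, hb, hb', hc, hc' hε1, hd, fun hfc hrc _ =>
    have ⟨sopt, sbar, hopt, hsbar, hlim, hrates⟩ := he hfc hrc
    ⟨sopt, sbar, hopt, hsbar, hlim hε1, hrates⟩⟩
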